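/- **Setting.** Let $G$ be a finite group and $K_1,K_2,K_3\subseteq G$ subgroups. Put a Hilbert space $\mathbb C[G]$ on each edge of a $W\times H$ square lattice ($W,H\ge 1$), with horizontal edges pointing right and vertical edges pointing up. The left side is boundary $1$, the top side is boundary $2$, and the right and bottom sides together form boundary $3$ (so the patch is a triangle whose third edge is bent). Let $A_v^g$ multiply the edges leaving $v$ by $g$ from the left and those entering $v$ by $g^{-1}$ from the right. Let $A_v$ be the average of $A_v^g$ over $g\in G$ for a bulk vertex, over $g\in K_i$ for a vertex of boundary $i$, and over $g\in K_i\cap K_j$ at a corner of boundaries $i,j$. The codespace $\mathcal C$ of the quantum double $D(G)$ on the patch consists of the states stabilised by all $A_v$, by the projectors onto trivial flux through each plaquette, and, for each edge of boundary $i$, by the projector onto group elements in $K_i$. Let $\overline{|0\rangle}=\prod_vA_v\bigotimes_e|1\rangle_e$. For $g_1\in K_1$, $g_2\in K_2$ with $g_1g_2\in K_3$ and a plaquette $q$, let $|g_1,g_2\rangle=\prod_v A_v\,L^{g_1}_{\xi_1}L^{g_2}_{\xi_2}L^{g_1g_2}_{\xi_3}\bigotimes_e|1\rangle_e$, where $L^g_\xi$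 is left multiplication by $g$ on the edges crossed by $\xi$ and $\xi_1,\xi_2,\xi_3$ are the straight dual ribbons joining $q$ to the left, top and bottom sides. An electric triple consists of representations $\rho_1,\rho_2,\rho_3$ of $G$, vectors $v_1,v_2$ invariant under $K_1,K_2$, a covector $\ell_3$ invariant under $K_3$, and a $G$-equivariant map $T:V_1\otimes V_2\to V_3$ with $\ell_3(T(v_1\otimes v_2))=1$. Given a vertex $c$, its logical operator $\overline Z$ is the diagonal operator that transports $v_1,v_2,\ell_3$ along the straight lattice lines joining $c$ to the left, top and right sides and contracts them at $c$ with $T$. It has braiding $-1$ with $(g_1,g_2)$ if $\ell_3(T(v_1\otimes\rho_2(g_1)v_2))=-1$; such a pair encodes a logical qubit with $\overline{|1\rangle}=|g_1,g_2\rangle$. Let $\alpha:G\times G\to U(1)$ be a 2-cocycle, and let $\beta^{(i)}:G\to U(1)$ satisfy $\alpha(g,h)=\beta^{(i)}(g)\beta^{(i)}(h)/\beta^{(i)}(gh)$ for $g,h\in K_i$, and $\beta^{(i)}=\beta^{(j)}$ on $K_i\cap K_j$, for all $i,j\in\{1,2,3\}$. Let $$U_{\alpha,\beta}=\prod_pM_p^\alpha\prod_{e\in\mathfrak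 B_1}\bigl(M_e^{\beta^{(1)}}\bigr)^\dagger\prod_{e\in\mathfrak B_2}\bigl(M_e^{\beta^{(2)}}\bigr)^\dagger\prod_{e\in\mathfrak B_3}M_e^{\beta^{(3)}},$$ where $\mathfrak B_i$ is the set of edges of boundary $i$, $M_e^\beta|g\rangle_e=\beta(g)|g\rangle_e$, and $M_p^\alpha$ multiplies a plaquette with group elements $g_1,g_2,g_3,g_4$ on its left, top, right and bottom edge by $\alpha(g_1,g_2)/\alpha(g_4,g_3)$. **Theorem.** 1. $U_{\alpha,\beta}$ is unitary and is a circuit of depth at most $3$, each layer of which is a product of unitary gates with disjoint supports, every gate acting on edges of a single plaquette. If an operator $O$ is supported on a set $S$ of edges, then $U_{\alpha,\beta}OU_{\alpha,\beta}^\dagger$ is supported on $S$ together with the plaquettes that meet $S$, which is a set of at most $7|S|$ edges. 2. $U_{\alpha,\beta}\,\mathcal C=\mathcal C$. 3. $\overline{|0\rangle}$ is a nonzero element of $\mathcal C$ and $U_{\alpha,\beta}\overline{|0\rangle}=\overline{|0\rangle}$. For all $q$ and all $g_1\in K_1$, $g_2\in K_2$ with $g_1g_2\in K_3$, $|g_1,g_2\rangle$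 is a nonzero element of $\mathcal C$ and $$U_{\alpha,\beta}|g_1,g_2\rangle=\frac{\alpha(g_1,g_2)\,\beta^{(3)}(g_1g_2)}{\beta^{(1)}(g_1)\,\beta^{(2)}(g_2)}\,|g_1,g_2\rangle .$$ 4. If an electric triple has braiding $-1$ with $(g_1,g_2)$, then for all $c$ and $q$ its operator $\overline Z$ maps $\mathcal C$ into itself, $\overline Z\,\overline{|0\rangle}=\overline{|0\rangle}$, $\overline Z\,\overline{|1\rangle}=-\overline{|1\rangle}$ and $\overline{\langle0}|\overline{1\rangle}=0$ for $\overline{|1\rangle}=|g_1,g_2\rangle$. Hence $U_{\alpha,\beta}$ is diagonal in the $\overline Z$ basis of the logical qubit. 5. If $\dim\mathcal C=2$, then for every state $|g_1,g_2\rangle\neq\overline{|0\rangle}$ as in 3, $\{\overline{|0\rangle},|g_1,g_2\rangle\}$ is an orthogonal basis of $\mathcal C$, so $U_{\alpha,\beta}$ is diagonal on all of $\mathcal C$. -/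

import Mathlib

/-! Kitaev's quantum double `D(G)` on a `W × H` square-lattice patch with three gapped boundaries,
the diagonal circuit that stacks a two-dimensional SPT layer on it, and notions of locality for
operators and circuits. -/

namespace SPTGate

noncomputable section

/-! ### The lattice -/

/-- Vertices `(x, y)`, with `0 ≤ x ≤ W` and `0 ≤ y ≤ H`. -/
abbrev Vertex (W H : ℕ) : Type := Fin (W + 1) × Fin (H + 1)

/-- Plaquettes, named by their lower left corner. -/
abbrev Plaquette (W H : ℕ) : Type := Fin W × Fin H

/-- Edges: `Sum.inl (x, y)` is the horizontal edge `(x, y) → (x + 1, y)`, pointing right, and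
`Sum.inr (x, y)` is the vertical edge `(x, y) → (x, y + 1)`, pointing up. -/
abbrev Edge (W H : ℕ) : Type := (Fin W × Fin (H + 1)) ⊕ (Fin (W + 1) × Fin H)

section Lattice

variable {W H : ℕ}

/-- Initial vertex of an edge. -/
def src : Edge W H → Vertex W H
  | Sum.inl (x, y) => (x.castSucc, y)
  | Sum.inr (x, y) => (x, y.castSucc)

/-- Terminal vertex of an edge. -/
def tgt : Edge W H → Vertex W H
  | Sum.inl (x, y) => (x.succ, y)
  | Sum.inr (x, y) => (x, y.succ)

/-- Left edge of a plaquette. -/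
def leftEdge (p : Plaquette W H) : Edge W H := Sum.inr (p.1.castSucc, p.2)

/-- Top edge of a plaquette. -/
def topEdge (p : Plaquette W H) : Edge W H := Sum.inl (p.1, p.2.succ)

/-- Right edge of a plaquette. -/
def rightEdge (p : Plaquette W H) : Edge W H := Sum.inr (p.1.succ, p.2)

/-- Bottom edge of a plaquette. -/
def bottomEdge (p : Plaquette W H) : Edge W H := Sum.inl (p.1, p.2.castSucc)

/-- The four edges of a plaquette. -/
def plaquetteEdges (p : Plaquette W H) : Finset (Edge W H) :=
  {leftEdge p, topEdge p, rightEdge p, bottomEdge p}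

/-- The edges of the three boundaries of the patch. Boundary `0` is the left side, boundary `1` the
top side, and boundary `2` consists of the right and the bottom side: a triangle whose third edge
is bent at the lower right corner of the square. -/
def boundaryEdges : Fin 3 → Finset (Edge W H)
  | 0 => Finset.univ.image fun y : Fin H => Sum.inr (0, y)
  | 1 => Finset.univ.image fun x : Fin W => Sum.inl (x, Fin.last H)
  | 2 => (Finset.univ.image fun y : Fin H => Sum.inr (Fin.last W, y)) ∪
      Finset.univ.image fun x : Fin W => Sum.inl (x, 0)

/-- `S` together with all edges that share a plaquette with an edge of `S`. -/
def thicken (S : Finset (Edge W H)) : Finset (Edge W H) :=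
  S ∪ (Finset.univ.filter fun p : Plaquette W H => ¬ Disjoint (plaquetteEdges p) S).biUnion
    plaquetteEdges

end Lattice

/-! ### Hilbert space and operators -/

/-- A basis configuration: a group element on each edge. -/
abbrev Config (G : Type*) (W H : ℕ) := Edge W H → G

/-- Vectors of the Hilbert space `⨂ₑ ℂ[G]`, by their coefficients in the basis `⨂ₑ |h e⟩`. -/
abbrev State (G : Type*) (W H : ℕ) := Config G W H → ℂ

/-- Operators on the Hilbert space, by their matrices in the basis `⨂ₑ |h e⟩`. -/
abbrev Op (G : Type*) (W H : ℕ) := Matrix (Config G W H) (Config G W H) ℂ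

section Operators

variable {G : Type*} [Group G] [Fintype G] [DecidableEq G] {W H : ℕ}

/-- The operator `|h⟩ ↦ |σ h⟩`. -/
def permOp (σ : Config G W H → Config G W H) : Op G W H :=
  Matrix.of fun h h' => if h = σ h' then 1 else 0

/-- The product of the operators `f i`, `i ∈ s`. It is used for commuting families only, for which
the order does not matter. -/
def opProd {ι : Type*} (s : Finset ι) (f : ι → Op G W H) : Op G W H := (s.toList.map f).prod

/-- The basis vector `|h⟩`. -/
def ket (h : Config G W H) : State G W H := Pi.single h 1

/-- `A_v^g`: multiplication `h ↦ g h` on the edges that leave `v` and `h ↦ h g⁻¹` on those that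
enter `v` (edges outside the patch are dropped). -/
def vertexOp (v : Vertex W H) (g : G) : Op G W H :=
  permOp fun h e => (if src e = v then g else 1) * h e * (if tgt e = v then g⁻¹ else 1)

/-- `B_p^g`: the projector onto flux `g` through `p`. -/
def plaquetteOp (p : Plaquette W H) (g : G) : Op G W H :=
  Matrix.diagonal fun h =>
    if h (leftEdge p) * h (topEdge p) * (h (rightEdge p))⁻¹ * (h (bottomEdge p))⁻¹ = g
    then 1 else 0

/-- `B^g` at a boundary edge, where the outer plaquette is truncated to this edge: the projector
onto the group element `g` on `e`. -/
def edgeFluxOp (e : Edge W H) (g : G) : Op G W H :=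
  Matrix.diagonal fun h => if h e = g then 1 else 0

/-- The group of gauge transformations at a vertex, for boundary subgroups `K`: all of `G` in the
bulk, `K i` on boundary `i`, and the intersection `K i ⊓ K j` at a corner of boundaries `i`, `j`. -/
def vertexGroup (K : Fin 3 → Subgroup G) (v : Vertex W H) : Subgroup G :=
  ⨅ i : Fin 3, ⨅ _ : ∃ e ∈ boundaryEdges i, src e = v ∨ tgt e = v, K i

open Classical in
/-- `A_v`: the average of `A_v^g` over the gauge group of `v`. -/
def vertexProj (K : Fin 3 → Subgroup G) (v : Vertex W H) : Op G W H :=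
  (Nat.card (vertexGroup K v) : ℂ)⁻¹ •
    ∑ g ∈ Finset.univ.filter (fun g => g ∈ vertexGroup K v), vertexOp v g

open Classical in
/-- `B^K = ∑_{k ∈ K} B^k` at a boundary edge. -/
def boundaryProj (L : Subgroup G) (e : Edge W H) : Op G W H :=
  ∑ g ∈ Finset.univ.filter (fun g => g ∈ L), edgeFluxOp e g

/-- The codespace: the joint `+1` eigenspace of all vertex projectors (bulk and boundary), all
plaquette projectors `B_p = B_p^1`, and all boundary projectors `B^{K i}`. -/
def codespace (K : Fin 3 → Subgroup G) (W H : ℕ) : Submodule ℂ (State G W H) :=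
  (⨅ v : Vertex W H, LinearMap.eqLocus (vertexProj K v).mulVecLin LinearMap.id) ⊓
  (⨅ p : Plaquette W H, LinearMap.eqLocus (plaquetteOp p (1 : G)).mulVecLin LinearMap.id) ⊓
  (⨅ i : Fin 3, ⨅ e : Edge W H, ⨅ _ : e ∈ boundaryEdges i,
    LinearMap.eqLocus (boundaryProj (K i) e).mulVecLin LinearMap.id)

/-! ### Logical states -/

/-- `L_ξ^g`: left multiplication by `g` on all edges of `ξ`. -/
def ribbonOp (ξ : Finset (Edge W H)) (g : G) : Op G W H :=
  permOp fun h e => if e ∈ ξ then g * h e else h e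

/-- The edges crossed by the dual ribbon from the left boundary to the plaquette `q`. -/
def ribbon₁ (q : Plaquette W H) : Finset (Edge W H) :=
  (Finset.univ.filter fun x : Fin (W + 1) => x ≤ q.1.castSucc).image fun x => Sum.inr (x, q.2)

/-- The edges crossed by the dual ribbon from the top boundary to the plaquette `q`. -/
def ribbon₂ (q : Plaquette W H) : Finset (Edge W H) :=
  (Finset.univ.filter fun y : Fin (H + 1) => q.2.succ ≤ y).image fun y => Sum.inl (q.1, y)

/-- The edges crossed by the dual ribbon from the plaquette `q` to the bottom boundary. -/
def ribbon₃ (q : Plaquette W H) : Finset (Edge W H) :=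
  (Finset.univ.filter fun y : Fin (H + 1) => y ≤ q.2.castSucc).image fun y => Sum.inl (q.1, y)

/-- The trivial ground state `|id, id⟩ = ∏_v A_v ⨂ₑ |1⟩`, which is the logical `|0⟩`. -/
def ketZero (K : Fin 3 → Subgroup G) (W H : ℕ) : State G W H :=
  (opProd Finset.univ (vertexProj (W := W) (H := H) K)).mulVec (ket 1)

/-- The state `|g₁, g₂⟩ = ∏_v A_v L_{ξ₁}^{g₁} L_{ξ₂}^{g₂} L_{ξ₃}^{g₁ g₂} ⨂ₑ |1⟩` of three magnetic
anyons that start on the three boundaries and meet at the plaquette `q`. -/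
def ketMagnetic (K : Fin 3 → Subgroup G) (q : Plaquette W H) (g₁ g₂ : G) : State G W H :=
  (opProd Finset.univ (vertexProj (W := W) (H := H) K) *
    ribbonOp (ribbon₁ q) g₁ * ribbonOp (ribbon₂ q) g₂ * ribbonOp (ribbon₃ q) (g₁ * g₂)).mulVec
    (ket 1)

/-- A triple of electric anyons on the three boundaries, meeting at a trivalent junction: three
representations of `G`; vectors (a covector for the outgoing third one) invariant under `K 0`, `K 1`,
`K 2`, by which the anyons end on the boundaries; and a fusion map `V₁ ⊗ V₂ → V₃` of
representations. The amplitude of the network in the vacuum is normalised to one. Irreducibility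
(that is, pure anyon labels) is allowed, but is not required. -/
structure ElectricTriplet (K : Fin 3 → Subgroup G) (V₁ V₂ V₃ : Type*)
    [AddCommGroup V₁] [Module ℂ V₁] [AddCommGroup V₂] [Module ℂ V₂]
    [AddCommGroup V₃] [Module ℂ V₃] where
  ρ₁ : Representation ℂ G V₁
  ρ₂ : Representation ℂ G V₂
  ρ₃ : Representation ℂ G V₃
  v₁ : V₁
  v₂ : V₂
  l₃ : V₃ →ₗ[ℂ] ℂ
  fusion : V₁ →ₗ[ℂ] V₂ →ₗ[ℂ] V₃
  v₁_inv : ∀ k ∈ K 0, ρ₁ k v₁ = v₁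
  v₂_inv : ∀ k ∈ K 1, ρ₂ k v₂ = v₂
  l₃_inv : ∀ k ∈ K 2, ∀ w, l₃ (ρ₃ k w) = l₃ w
  fusion_equivariant : ∀ g a b, fusion (ρ₁ g a) (ρ₂ g b) = ρ₃ g (fusion a b)
  normalised : l₃ (fusion v₁ v₂) = 1

section Electric

variable {K : Fin 3 → Subgroup G} {V₁ V₂ V₃ : Type*}
    [AddCommGroup V₁] [Module ℂ V₁] [AddCommGroup V₂] [Module ℂ V₂]
    [AddCommGroup V₃] [Module ℂ V₃]

/-- The braiding of an electric triple with the magnetic triple `([g₁], [g₂], [g₁ g₂])`: the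
flux `g₁` links with the second electric anyon. -/
def ElectricTriplet.braiding (b : ElectricTriplet K V₁ V₂ V₃) (g₁ : G) : ℂ :=
  b.l₃ (b.fusion b.v₁ (b.ρ₂ g₁ b.v₂))

/-- Holonomy of `h` from the left end of the row of `c` to `c`. -/
def holLeft (h : Config G W H) (c : Vertex W H) : G :=
  (((List.finRange W).filter fun x => x.castSucc < c.1).map fun x => h (Sum.inl (x, c.2))).prod

/-- Holonomy of `h` from `c` to the right end of the row of `c`. -/
def holRight (h : Config G W H) (c : Vertex W H) : G :=
  (((List.finRange W).filter fun x => c.1 ≤ x.castSucc).map fun x => h (Sum.inl (x, c.2))).prod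

/-- Holonomy of `h` from `c` to the top end of the column of `c`. -/
def holUp (h : Config G W H) (c : Vertex W H) : G :=
  (((List.finRange H).filter fun y => c.2 ≤ y.castSucc).map fun y => h (Sum.inr (c.1, y))).prod

/-- The logical operator `Z` of an electric triple whose lines run straight from the left, top and
right boundary to the vertex `c`: a diagonal operator, which transports the three boundary vectors
along the lines and contracts them at `c`. -/
def logicalZ (b : ElectricTriplet K V₁ V₂ V₃) (c : Vertex W H) : Op G W H :=
  Matrix.diagonal fun h =>
    b.l₃ (b.ρ₃ (holRight h c)⁻¹
      (b.fusion (b.ρ₁ (holLeft h c)⁻¹ b.v₁) (b.ρ₂ (holUp h c) b.v₂)))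

end Electric

/-! ### The SPT circuit -/

/-- `α` is a 2-cocycle of `G` with values in `U(1)` (with trivial action). -/
def IsTwoCocycle (α : G → G → Circle) : Prop :=
  ∀ g h k, α g h * α (g * h) k = α g (h * k) * α h k

/-- `α = δβ` on the subgroup `L`. -/
def TrivialisesOn (α : G → G → Circle) (L : Subgroup G) (β : G → Circle) : Prop :=
  ∀ g ∈ L, ∀ h ∈ L, α g h = β g * β h / β (g * h)

/-- `M_p^α`: the cocycle evaluated on a plaquette that is cut along its diagonal from the lower left
to the upper right corner. With edges `g₁, g₂, g₃, g₄` (left, top, right, bottom), the two triangles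
contribute `α(g₁, g₂)` and `α(g₄, g₃)⁻¹`. -/
def plaquetteGate (α : G → G → Circle) (p : Plaquette W H) : Op G W H :=
  Matrix.diagonal fun h =>
    ((α (h (leftEdge p)) (h (topEdge p)) / α (h (bottomEdge p)) (h (rightEdge p)) : Circle) : ℂ)

/-- `M_e^β`: the counterterm on a boundary edge. -/
def edgeGate (β : G → Circle) (e : Edge W H) : Op G W H :=
  Matrix.diagonal fun h => (β (h e) : ℂ)

/-- The unitary `U_{α,β}`. -/
def sptGate (α : G → G → Circle) (β : Fin 3 → G → Circle) (W H : ℕ) : Op G W H :=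
  opProd Finset.univ (plaquetteGate α) *
    opProd (boundaryEdges 0) (fun e => (edgeGate (β 0) e).conjTranspose) *
    opProd (boundaryEdges 1) (fun e => (edgeGate (β 1) e).conjTranspose) *
    opProd (boundaryEdges 2) (edgeGate (β 2))

/-! ### Locality -/

/-- `O` is supported on the set `S` of edges, that is `O = O_S ⊗ 1`: its matrix elements vanish
between configurations that differ outside `S`, and otherwise depend only on the restrictions
to `S`. -/
def SupportedOn (S : Finset (Edge W H)) (O : Op G W H) : Prop :=
  (∀ h h', (∃ e ∉ S, h e ≠ h' e) → O h h' = 0) ∧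
  (∀ h h' k k', (∀ e ∈ S, h e = k e ∧ h' e = k' e) → (∀ e ∉ S, h e = h' e ∧ k e = k' e) →
    O h h' = O k k')

/-- One layer of a geometrically local circuit: a product of unitary gates with pairwise disjoint
supports, each supported on edges of a single plaquette (so on at most four edges). -/
def IsLocalLayer (O : Op G W H) : Prop :=
  ∃ gates : List (Finset (Edge W H) × Op G W H),
    gates.Pairwise (fun a b => Disjoint a.1 b.1) ∧
    (∀ a ∈ gates, a.2 ∈ Matrix.unitaryGroup (Config G W H) ℂ ∧ SupportedOn a.1 a.2 ∧
      ∃ p, a.1 ⊆ plaquetteEdges p) ∧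
    O = (gates.map Prod.snd).prod

/-- `O` is a geometrically local circuit of depth at most `d`. -/
def IsLocalCircuit (d : ℕ) (O : Op G W H) : Prop :=
  ∃ layers : List (Op G W H),
    layers.length ≤ d ∧ (∀ L ∈ layers, IsLocalLayer L) ∧ O = layers.prod

end Operators

end

end SPTGate

open SPTGate

/-! Every gate of the circuit is diagonal, so `sptGate` multiplies each configuration by a phase
`sptPhase`. The product of the vertex projectors is the average over all gauge transformations
compatible with the boundary subgroups (`opProd_vertexProj`). Hence the codespace is the space of
gauge invariant functions supported on flat configurations with boundary values in the `K i`
(`mem_codespace_iff`), and the logical states are gauge averages of single configurations. Two such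
states are equal or orthogonal, according to whether their orbits meet. A diagonal operator whose
entries are constant along an orbit has the orbit state as an eigenvector, and the eigenvalue can be
read off at one representative.

For the phase, constancy (`sptPhase_gauge`) is a discrete Stokes argument. A gauge transformation
changes the cocycle on a triangle by the coboundary of an edge cochain (`cocycle_gauge`). By
flatness the two triangles of a plaquette agree on their common diagonal, whose contribution
cancels. Interior edges cancel between neighbouring plaquettes (`prod_plaquette_div`), and only the
boundary of the patch remains. There `α = δβ` splits the cochain into an edge part, which the
counterterms absorb, and a vertex part, which telescopes along each boundary to its corners, where
the `β i` agree. At `magneticConfig` all unwanted constants cancel and the stated eigenvalue is left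
(`sptPhase_magneticConfig`).

The logical `Z` is treated in the same way. Equivariance of the fusion map and invariance of the
boundary vectors make its entries gauge invariant; they equal one on the vacuum and the braiding on
the magnetic configuration.

For locality, a checkerboard colouring of the plaquettes gives two layers and the counterterms a
third. Conjugation by a diagonal unitary multiplies each matrix entry by a ratio of phases, in which
every gate that does not meet the support of the operator drops out. -/

namespace SPTGate

open Matrix

set_option linter.unusedSectionVars false

/-! ### Averages over subgroups -/

section Average

variable {A R : Type*} [Group A] [Fintype A] [Ring R] [Algebra ℂ R]

open Classical in
/-- The average of a representation over a subgroup. -/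
noncomputable def subgroupAverage (ρ : A →* R) (S : Subgroup A) : R :=
  (Nat.card S : ℂ)⁻¹ • ∑ g ∈ Finset.univ.filter (fun g => g ∈ S), ρ g

lemma mul_subgroupAverage (ρ : A →* R) {S : Subgroup A} {s : A} (hs : s ∈ S) :
    ρ s * subgroupAverage ρ S = subgroupAverage ρ S := by
  classical
  unfold subgroupAverage
  rw [mul_smul_comm, Finset.mul_sum]
  congr 1
  refine Finset.sum_equiv (Equiv.mulLeft s) (fun g => ?_) (fun g _ => ?_)
  · simp [Subgroup.mul_mem_cancel_left S hs]
  · simp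

lemma subgroupAverage_mul (ρ : A →* R) {S : Subgroup A} {s : A} (hs : s ∈ S) :
    subgroupAverage ρ S * ρ s = subgroupAverage ρ S := by
  classical
  unfold subgroupAverage
  rw [smul_mul_assoc, Finset.sum_mul]
  congr 1
  refine Finset.sum_equiv (Equiv.mulRight s) (fun g => ?_) (fun g _ => ?_)
  · simp [Subgroup.mul_mem_cancel_right S hs]
  · simp

/-- An element fixed by the subgroup absorbs the average. -/
lemma subgroupAverage_mul_of_fixed (ρ : A →* R) {S : Subgroup A} {x : R}
    (hx : ∀ s ∈ S, ρ s * x = x) : subgroupAverage ρ S * x = x := by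
  classical
  unfold subgroupAverage
  rw [smul_mul_assoc, Finset.sum_mul, Finset.sum_congr rfl
    (fun g hg => hx g (Finset.mem_filter.1 hg).2), Finset.sum_const, ← Nat.cast_smul_eq_nsmul ℂ,
    smul_smul]
  have : (Finset.univ.filter (fun g => g ∈ S)).card = Nat.card S := by
    rw [Nat.card_eq_fintype_card, Fintype.card_subtype]
  rw [this, inv_mul_cancel₀, one_smul]
  exact_mod_cast Nat.card_pos.ne'

lemma mul_subgroupAverage_of_fixed (ρ : A →* R) {S : Subgroup A} {x : R}
    (hx : ∀ s ∈ S, x * ρ s = x) : x * subgroupAverage ρ S = x := by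
  classical
  unfold subgroupAverage
  rw [mul_smul_comm, Finset.mul_sum, Finset.sum_congr rfl
    (fun g hg => hx g (Finset.mem_filter.1 hg).2), Finset.sum_const, ← Nat.cast_smul_eq_nsmul ℂ,
    smul_smul]
  have : (Finset.univ.filter (fun g => g ∈ S)).card = Nat.card S := by
    rw [Nat.card_eq_fintype_card, Fintype.card_subtype]
  rw [this, inv_mul_cancel₀, one_smul]
  exact_mod_cast Nat.card_pos.ne'

lemma commute_subgroupAverage (ρ : A →* R) (S : Subgroup A) {x : R}
    (hx : ∀ s, Commute x (ρ s)) : Commute x (subgroupAverage ρ S) :=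
  (Commute.sum_right _ _ _ fun s _ => hx s).smul_right _

end Average

variable {G : Type*} [Group G] [Fintype G] [DecidableEq G] {W H : ℕ}

/-! ### Diagonal operators -/

/-- `Matrix.diagonal` is a ring homomorphism from a commutative ring of functions, so the order
chosen by `Finset.toList` is immaterial. -/
lemma opProd_diagonal {ι : Type*} (s : Finset ι) (d : ι → Config G W H → ℂ) :
    opProd s (fun i => Matrix.diagonal (d i)) = Matrix.diagonal fun h => ∏ i ∈ s, d i h := by
  have : (fun i => Matrix.diagonal (d i)) =
      fun i => Matrix.diagonalRingHom (Config G W H) ℂ (d i) := rfl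
  rw [opProd, this, ← Function.comp_def, ← List.map_map, ← map_list_prod,
    Finset.prod_map_toList]
  change Matrix.diagonal _ = _
  congr 1
  ext h
  simp

/-- The phase by which `plaquetteGate` multiplies a configuration. -/
noncomputable def plaquettePhase (α : G → G → Circle) (p : Plaquette W H) (h : Config G W H) :
    Circle :=
  α (h (leftEdge p)) (h (topEdge p)) / α (h (bottomEdge p)) (h (rightEdge p))

/-- The phase by which `sptGate` multiplies a configuration. -/
noncomputable def sptPhase (α : G → G → Circle) (β : Fin 3 → G → Circle) (h : Config G W H) :
    Circle :=
  (∏ p, plaquettePhase α p h) * (∏ e ∈ boundaryEdges 0, (β 0 (h e))⁻¹) *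
    (∏ e ∈ boundaryEdges 1, (β 1 (h e))⁻¹) * ∏ e ∈ boundaryEdges 2, β 2 (h e)

lemma coe_circle_prod {ι : Type*} (s : Finset ι) (f : ι → Circle) :
    ((∏ i ∈ s, f i : Circle) : ℂ) = ∏ i ∈ s, (f i : ℂ) :=
  map_prod Circle.coeHom f s

lemma edgeGate_conjTranspose (β : G → Circle) (e : Edge W H) :
    (edgeGate β e).conjTranspose = Matrix.diagonal fun h => (((β (h e))⁻¹ : Circle) : ℂ) := by
  rw [edgeGate, Matrix.diagonal_conjTranspose]
  congr 1
  ext h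
  exact (Circle.coe_inv_eq_conj _).symm

lemma sptGate_eq_diagonal (α : G → G → Circle) (β : Fin 3 → G → Circle) :
    sptGate α β W H = Matrix.diagonal fun h => (sptPhase α β h : ℂ) := by
  unfold sptGate plaquetteGate
  simp only [edgeGate_conjTranspose]
  unfold edgeGate
  simp only [opProd_diagonal, Matrix.diagonal_mul_diagonal]
  congr 1
  ext h
  simp only [sptPhase, plaquettePhase, Circle.coe_mul, coe_circle_prod]

/-! ### Gauge transformations -/

/-- The gauge transformation of a configuration by a group element at each vertex. -/
def gauge (γ : Vertex W H → G) (h : Config G W H) : Config G W H :=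
  fun e => γ (src e) * h e * (γ (tgt e))⁻¹

lemma gauge_one (h : Config G W H) : gauge 1 h = h := by
  ext e; simp [gauge]

lemma gauge_mul (γ δ : Vertex W H → G) (h : Config G W H) :
    gauge (γ * δ) h = gauge γ (gauge δ h) := by
  ext e; simp [gauge, mul_assoc]

lemma gauge_inv_gauge (γ : Vertex W H → G) (h : Config G W H) : gauge γ⁻¹ (gauge γ h) = h := by
  rw [← gauge_mul, inv_mul_cancel, gauge_one]

lemma gauge_gauge_inv (γ : Vertex W H → G) (h : Config G W H) : gauge γ (gauge γ⁻¹ h) = h := by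
  rw [← gauge_mul, mul_inv_cancel, gauge_one]

lemma permOp_mul (σ τ : Config G W H → Config G W H) :
    permOp σ * permOp τ = permOp (σ ∘ τ) := by
  ext h h'
  simp [permOp, Matrix.mul_apply]

lemma permOp_id : permOp (id : Config G W H → Config G W H) = 1 := by
  ext h h'
  simp [permOp, Matrix.one_apply]

lemma permOp_mulVec_ket (σ : Config G W H → Config G W H) (h : Config G W H) :
    (permOp σ).mulVec (ket h) = ket (σ h) := by
  ext k
  simp [permOp, ket, Pi.single_apply]

/-- The representation of gauge transformations on the Hilbert space. -/
def gaugeRep : (Vertex W H → G) →* Op G W H where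
  toFun γ := permOp (gauge γ)
  map_one' := by rw [← permOp_id]; congr 1; ext1 h; exact gauge_one h
  map_mul' γ δ := by rw [permOp_mul]; congr 1; ext1 h; exact gauge_mul γ δ h

lemma gaugeRep_mulVec_ket (γ : Vertex W H → G) (h : Config G W H) :
    (gaugeRep γ).mulVec (ket h) = ket (gauge γ h) :=
  permOp_mulVec_ket _ _

lemma gaugeRep_mulVec_apply (γ : Vertex W H → G) (ψ : State G W H) (h : Config G W H) :
    (gaugeRep γ).mulVec ψ h = ψ (gauge γ⁻¹ h) := by
  change ∑ k, (if h = gauge γ k then 1 else 0) * ψ k = _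
  rw [Finset.sum_eq_single (gauge γ⁻¹ h)]
  · simp [gauge_gauge_inv]
  · intro k _ hk
    rw [if_neg, zero_mul]
    rintro rfl
    exact hk (gauge_inv_gauge γ k).symm
  · simp

lemma vertexOp_eq (v : Vertex W H) (g : G) :
    vertexOp v g = gaugeRep (Pi.mulSingle v g) := by
  change permOp _ = permOp _
  congr 1
  ext h e
  simp only [gauge, Pi.mulSingle_apply]
  split_ifs <;> simp

lemma vertexProj_eq (K : Fin 3 → Subgroup G) (v : Vertex W H) :
    vertexProj K v =
      subgroupAverage (gaugeRep.comp (MonoidHom.mulSingle (fun _ : Vertex W H => G) v))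
        (vertexGroup K v) := by
  unfold vertexProj subgroupAverage
  simp only [vertexOp_eq]
  rfl

/-- The gauge transformations compatible with the boundary subgroups. -/
def gaugeGroup (K : Fin 3 → Subgroup G) (W H : ℕ) : Subgroup (Vertex W H → G) :=
  Subgroup.pi Set.univ (vertexGroup K)

lemma mulSingle_mem_gaugeGroup {K : Fin 3 → Subgroup G} {v : Vertex W H} {g : G}
    (hg : g ∈ vertexGroup K v) : Pi.mulSingle v g ∈ gaugeGroup K W H := by
  intro w _
  by_cases hw : w = v
  · subst hw; simpa using hg
  · rw [Pi.mulSingle_eq_of_ne hw]; exact one_mem (vertexGroup K w)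

/-- There are finitely many vertices, so the product group is generated by its elements supported at
one vertex. -/
lemma gaugeGroup_induction {K : Fin 3 → Subgroup G} {S : Subgroup (Vertex W H → G)}
    (hS : ∀ v, ∀ g ∈ vertexGroup K v, Pi.mulSingle v g ∈ S) : gaugeGroup K W H ≤ S := by
  rw [gaugeGroup, Subgroup.pi_le_iff]
  rintro v _ ⟨g, hg, rfl⟩
  exact hS v g hg

/-- The transformation at `v` commutes with the projectors at other vertices until it meets the one
at `v`, which absorbs it. -/
lemma gaugeRep_mulSingle_mul_prod {K : Fin 3 → Subgroup G} {v : Vertex W H} {g : G}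
    (hg : g ∈ vertexGroup K v) (l : List (Vertex W H)) (hv : v ∈ l) :
    gaugeRep (Pi.mulSingle v g) * (l.map (vertexProj K)).prod = (l.map (vertexProj K)).prod := by
  induction l with
  | nil => simp at hv
  | cons a l ih =>
    rw [List.map_cons, List.prod_cons, ← mul_assoc]
    by_cases h : v = a
    · subst h
      rw [vertexProj_eq]
      congr 1
      exact mul_subgroupAverage
        (gaugeRep.comp (MonoidHom.mulSingle (fun _ : Vertex W H => G) v)) hg
    · have hc : Commute (gaugeRep (Pi.mulSingle v g)) (vertexProj K a) := by
        rw [vertexProj_eq]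
        exact commute_subgroupAverage _ _ fun s =>
          (Pi.mulSingle_commute (f := fun _ : Vertex W H => G) h g s).map gaugeRep
      rw [hc.eq, mul_assoc, ih ((List.mem_cons.1 hv).resolve_left h)]

/-- The subgroup of gauge transformations that fix an operator from the left. -/
def gaugeStabilizer (O : Op G W H) : Subgroup (Vertex W H → G) where
  carrier := {γ | gaugeRep γ * O = O}
  one_mem' := by simp
  mul_mem' {γ δ} hγ hδ := by
    simp only [Set.mem_ofPred_eq] at *
    rw [map_mul, mul_assoc, hδ, hγ]
  inv_mem' {γ} hγ := by
    simp only [Set.mem_ofPred_eq] at *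
    calc _ = gaugeRep γ⁻¹ * (gaugeRep γ * O) := by rw [hγ]
      _ = O := by rw [← mul_assoc, ← map_mul]; simp

/-- The product of all vertex projectors is the average over the gauge group. -/
lemma opProd_vertexProj (K : Fin 3 → Subgroup G) :
    opProd Finset.univ (vertexProj (W := W) (H := H) K) =
      subgroupAverage gaugeRep (gaugeGroup K W H) := by
  -- With `P` the average and `Q` the product of projectors, `h1` is `P * Q = Q` and `h2` gives `P *
  -- Q = P`.
  have h1 : subgroupAverage gaugeRep (gaugeGroup K W H) *
      opProd Finset.univ (vertexProj (W := W) (H := H) K) = opProd Finset.univ (vertexProj K) := by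
    refine subgroupAverage_mul_of_fixed _ fun γ hγ => ?_
    refine gaugeGroup_induction (S := gaugeStabilizer _) (fun v g hg => ?_) hγ
    exact gaugeRep_mulSingle_mul_prod hg _ (by simp)
  have h2 : ∀ l : List (Vertex W H), subgroupAverage gaugeRep (gaugeGroup K W H) *
      (l.map (vertexProj K)).prod = subgroupAverage gaugeRep (gaugeGroup K W H) := by
    intro l
    induction l with
    | nil => simp
    | cons a l ih =>
      have ha : subgroupAverage gaugeRep (gaugeGroup K W H) * vertexProj K a =
          subgroupAverage gaugeRep (gaugeGroup K W H) := by
        rw [vertexProj_eq]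
        refine mul_subgroupAverage_of_fixed _ fun s hs => ?_
        have hs' : (Pi.mulSingle a s : Vertex W H → G) ∈ gaugeGroup K W H :=
          mulSingle_mem_gaugeGroup hs
        have := subgroupAverage_mul (gaugeRep (G := G) (W := W) (H := H)) hs'
        rw [MonoidHom.comp_apply, MonoidHom.mulSingle_apply]
        exact this
      rw [List.map_cons, List.prod_cons, ← mul_assoc, ha, ih]
  rw [← h1, opProd, h2]

/-! ### The codespace -/

/-- The configurations allowed by all flux projectors: flat, with boundary edges in the boundary
subgroups. -/
def Admissible (K : Fin 3 → Subgroup G) (h : Config G W H) : Prop :=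
  (∀ p, h (leftEdge p) * h (topEdge p) = h (bottomEdge p) * h (rightEdge p)) ∧
    ∀ i, ∀ e ∈ boundaryEdges i, h e ∈ K i

lemma gaugeGroup_apply_mem {K : Fin 3 → Subgroup G} {γ : Vertex W H → G}
    (hγ : γ ∈ gaugeGroup K W H) {i : Fin 3} {e : Edge W H} (he : e ∈ boundaryEdges i)
    {v : Vertex W H} (hv : src e = v ∨ tgt e = v) : γ v ∈ K i := by
  have h : γ v ∈ vertexGroup K v := hγ v (Set.mem_univ v)
  simp only [vertexGroup, Subgroup.mem_iInf] at h
  exact h i ⟨e, he, hv⟩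

lemma Admissible.gauge {K : Fin 3 → Subgroup G} {h : Config G W H} (hh : Admissible K h)
    {γ : Vertex W H → G} (hγ : γ ∈ gaugeGroup K W H) : Admissible K (gauge γ h) := by
  refine ⟨fun p => ?_, fun i e he => ?_⟩
  · have := hh.1 p
    simp only [SPTGate.gauge, leftEdge, topEdge, bottomEdge, rightEdge, src, tgt] at this ⊢
    calc _ = γ (p.1.castSucc, p.2.castSucc) * (h (Sum.inr (p.1.castSucc, p.2)) *
          h (Sum.inl (p.1, p.2.succ))) * (γ (p.1.succ, p.2.succ))⁻¹ := by group
      _ = _ := by rw [this]; group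
  · exact mul_mem (mul_mem (gaugeGroup_apply_mem hγ he (Or.inl rfl)) (hh.2 i e he))
      (inv_mem (gaugeGroup_apply_mem hγ he (Or.inr rfl)))

lemma diagonal_mulVec_eq_self_iff (P : Config G W H → Prop) [DecidablePred P] (ψ : State G W H) :
    (Matrix.diagonal fun h => if P h then (1 : ℂ) else 0).mulVec ψ = ψ ↔
      ∀ h, ψ h ≠ 0 → P h := by
  rw [funext_iff]
  refine forall_congr' fun h => ?_
  rw [Matrix.mulVec_diagonal]
  by_cases hP : P h <;> simp [hP, eq_comm]

lemma boundaryProj_eq (L : Subgroup G) (e : Edge W H)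
    [DecidablePred fun h : Config G W H => h e ∈ L] :
    boundaryProj L e =
      Matrix.diagonal fun h : Config G W H => if h e ∈ L then (1 : ℂ) else 0 := by
  classical
  unfold boundaryProj edgeFluxOp
  have : ∀ (s : Finset G) (d : G → Config G W H → ℂ),
      ∑ g ∈ s, Matrix.diagonal (d g) = Matrix.diagonal (∑ g ∈ s, d g) := fun s d =>
    (map_sum (Matrix.diagonalAddMonoidHom (Config G W H) ℂ) d s).symm
  rw [this]
  congr 1
  ext h
  simp [Finset.sum_apply]

lemma gauge_invariant_of_vertexProj {K : Fin 3 → Subgroup G} {ψ : State G W H}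
    (hψ : ∀ v, (vertexProj K v).mulVec ψ = ψ) {γ : Vertex W H → G} (hγ : γ ∈ gaugeGroup K W H)
    (h : Config G W H) : ψ (gauge γ h) = ψ h := by
  have key : (opProd Finset.univ (vertexProj K)).mulVec ψ = ψ := by
    have : ∀ l : List (Vertex W H), ((l.map (vertexProj K)).prod).mulVec ψ = ψ := by
      intro l
      induction l with
      | nil => simp
      | cons a l ih => rw [List.map_cons, List.prod_cons, ← Matrix.mulVec_mulVec, ih, hψ]
    exact this _
  have h2 : (gaugeRep γ⁻¹).mulVec ψ = ψ := by
    rw [opProd_vertexProj] at key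
    rw [← key, Matrix.mulVec_mulVec, mul_subgroupAverage _ (inv_mem hγ)]
  conv_rhs => rw [← h2]
  rw [gaugeRep_mulVec_apply, inv_inv]

lemma vertexProj_mulVec_of_invariant {K : Fin 3 → Subgroup G} {ψ : State G W H}
    (hψ : ∀ γ ∈ gaugeGroup K W H, ∀ h, ψ (gauge γ h) = ψ h) (v : Vertex W H) :
    (vertexProj K v).mulVec ψ = ψ := by
  -- The averaging lemmas live in the operator algebra, so `ψ` is replaced by the matrix all of
  -- whose columns are `ψ`; any column of the result may be read off at the end.
  have h1 : ∀ g ∈ vertexGroup K v, gaugeRep (Pi.mulSingle v g) *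
      (Matrix.of fun h (_ : Config G W H) => ψ h) = Matrix.of fun h _ => ψ h := by
    intro g hg
    ext h k
    change (gaugeRep (Pi.mulSingle v g)).mulVec ψ h = ψ h
    rw [gaugeRep_mulVec_apply, hψ _ (inv_mem (mulSingle_mem_gaugeGroup hg))]
  have h2 := subgroupAverage_mul_of_fixed
    (gaugeRep.comp (MonoidHom.mulSingle (fun _ : Vertex W H => G) v)) h1
  rw [← vertexProj_eq] at h2
  ext h
  exact congrFun (congrFun h2 h) 1

/-- The codespace consists of the gauge invariant functions on admissible configurations. -/
lemma mem_codespace_iff {K : Fin 3 → Subgroup G} {ψ : State G W H} :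
    ψ ∈ codespace K W H ↔ (∀ γ ∈ gaugeGroup K W H, ∀ h, ψ (gauge γ h) = ψ h) ∧
      ∀ h, ψ h ≠ 0 → Admissible K h := by
  classical
  simp only [codespace, Submodule.mem_inf, Submodule.mem_iInf, LinearMap.mem_eqLocus,
    Matrix.mulVecLin_apply, LinearMap.id_coe, id_eq, plaquetteOp, boundaryProj_eq,
    diagonal_mulVec_eq_self_iff]
  constructor
  · rintro ⟨⟨h1, h2⟩, h3⟩
    refine ⟨fun γ hγ h => gauge_invariant_of_vertexProj h1 hγ h, fun h hh =>
      ⟨fun p => ?_, fun i e he => h3 i e he h hh⟩⟩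
    have := h2 p h hh
    rwa [mul_assoc, ← _root_.mul_inv_rev, mul_inv_eq_one] at this
  · rintro ⟨h1, h2⟩
    refine ⟨⟨fun v => vertexProj_mulVec_of_invariant h1 v, fun p h hh => ?_⟩,
      fun i e he h hh => (h2 h hh).2 i e he⟩
    rw [mul_assoc, ← _root_.mul_inv_rev, mul_inv_eq_one]
    exact (h2 h hh).1 p

/-- Invariance of `f` is needed on admissible configurations only, because code states vanish on all
others. -/
lemma diagonal_mulVec_mem_codespace {K : Fin 3 → Subgroup G} {f : Config G W H → ℂ}
    (hf : ∀ γ ∈ gaugeGroup K W H, ∀ h, Admissible K h → f (gauge γ h) = f h)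
    {ψ : State G W H} (hψ : ψ ∈ codespace K W H) :
    (Matrix.diagonal f).mulVec ψ ∈ codespace K W H := by
  rw [mem_codespace_iff] at hψ ⊢
  refine ⟨fun γ hγ h => ?_, fun h hh => hψ.2 h fun h0 => hh ?_⟩
  · rw [Matrix.mulVec_diagonal, Matrix.mulVec_diagonal, hψ.1 γ hγ]
    by_cases h0 : ψ h = 0
    · simp [h0]
    · rw [hf γ hγ h (hψ.2 h h0)]
  · rw [Matrix.mulVec_diagonal, h0, mul_zero]

/-! ### Orbit states -/

/-- The gauge average of a basis vector. -/
noncomputable def orbitState (K : Fin 3 → Subgroup G) (h : Config G W H) : State G W H :=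
  (opProd Finset.univ (vertexProj K)).mulVec (ket h)

/-- The coefficient at `k` counts the gauge transformations that carry `h` to `k`, up to a positive
factor, so nothing can cancel. -/
lemma orbitState_apply_ne_zero_iff {K : Fin 3 → Subgroup G} {h k : Config G W H} :
    orbitState K h k ≠ 0 ↔ ∃ γ ∈ gaugeGroup K W H, gauge γ h = k := by
  classical
  have hsum : orbitState K h k = (Nat.card (gaugeGroup K W H) : ℂ)⁻¹ *
      ((Finset.univ.filter fun γ => γ ∈ gaugeGroup K W H).filter
        fun γ => k = gauge γ h).card := by
    rw [orbitState, opProd_vertexProj, subgroupAverage, Matrix.smul_mulVec, Matrix.sum_mulVec]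
    simp only [gaugeRep_mulVec_ket]
    simp only [Pi.smul_apply, Finset.sum_apply, smul_eq_mul, ket, Pi.single_apply,
      Finset.sum_boole]
  have hc : (Nat.card (gaugeGroup K W H) : ℂ) ≠ 0 := by exact_mod_cast Nat.card_pos.ne'
  rw [hsum, mul_ne_zero_iff_left (inv_ne_zero hc), Nat.cast_ne_zero, ← Nat.pos_iff_ne_zero,
    Finset.card_pos]
  simp only [Finset.Nonempty, Finset.mem_filter, Finset.mem_univ, true_and, eq_comm]

lemma orbitState_ne_zero (K : Fin 3 → Subgroup G) (h : Config G W H) : orbitState K h ≠ 0 :=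
  fun h0 => orbitState_apply_ne_zero_iff.2 ⟨1, one_mem _, gauge_one h⟩ (congrFun h0 h)

lemma orbitState_gauge {K : Fin 3 → Subgroup G} {γ : Vertex W H → G} (hγ : γ ∈ gaugeGroup K W H)
    (h : Config G W H) : orbitState K (gauge γ h) = orbitState K h := by
  rw [orbitState, orbitState, ← gaugeRep_mulVec_ket, Matrix.mulVec_mulVec, opProd_vertexProj,
    subgroupAverage_mul _ hγ]

lemma orbitState_apply_gauge {K : Fin 3 → Subgroup G} {γ : Vertex W H → G}
    (hγ : γ ∈ gaugeGroup K W H) (h k : Config G W H) :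
    orbitState K h (gauge γ k) = orbitState K h k := by
  have h2 : (gaugeRep γ⁻¹).mulVec (orbitState K h) = orbitState K h := by
    rw [orbitState, opProd_vertexProj, Matrix.mulVec_mulVec, mul_subgroupAverage _ (inv_mem hγ)]
  conv_rhs => rw [← h2]
  rw [gaugeRep_mulVec_apply, inv_inv]

lemma orbitState_mem_codespace {K : Fin 3 → Subgroup G} {h : Config G W H}
    (hh : Admissible K h) : orbitState K h ∈ codespace K W H := by
  rw [mem_codespace_iff]
  refine ⟨fun γ hγ k => orbitState_apply_gauge hγ h k, fun k hk => ?_⟩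
  obtain ⟨γ, hγ, rfl⟩ := orbitState_apply_ne_zero_iff.1 hk
  exact hh.gauge hγ

lemma diagonal_mulVec_orbitState {K : Fin 3 → Subgroup G} {f : Config G W H → ℂ}
    {h : Config G W H} (hf : ∀ γ ∈ gaugeGroup K W H, f (gauge γ h) = f h) :
    (Matrix.diagonal f).mulVec (orbitState K h) = f h • orbitState K h := by
  ext k
  rw [Matrix.mulVec_diagonal, Pi.smul_apply, smul_eq_mul]
  by_cases hk : orbitState K h k = 0
  · simp [hk]
  · obtain ⟨γ, hγ, rfl⟩ := orbitState_apply_ne_zero_iff.1 hk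
    rw [hf γ hγ]

/-- Distinct orbit states are orthogonal. -/
lemma orbitState_orthogonal {K : Fin 3 → Subgroup G} {h h' : Config G W H}
    (hne : orbitState K h' ≠ orbitState K h) :
    star (orbitState K h) ⬝ᵥ orbitState K h' = 0 := by
  refine Finset.sum_eq_zero fun k _ => ?_
  by_contra hk
  rw [mul_eq_zero, not_or, Pi.star_apply, star_eq_zero] at hk
  obtain ⟨γ, hγ, h1⟩ := orbitState_apply_ne_zero_iff.1 hk.1
  obtain ⟨δ, hδ, h2⟩ := orbitState_apply_ne_zero_iff.1 hk.2
  exact hne (by rw [← orbitState_gauge hγ h, ← orbitState_gauge hδ h', h1, h2])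

/-! ### Products over the lattice -/

lemma prod_fin_div {M : Type*} [CommGroup M] (n : ℕ) (F : Fin (n + 1) → M) :
    ∏ i : Fin n, F i.castSucc / F i.succ = F 0 / F (Fin.last n) := by
  induction n with
  | zero => simp
  | succ n ih =>
    rw [Fin.prod_univ_castSucc]
    have := ih fun i => F i.castSucc
    simp only [← Fin.succ_castSucc] at *
    rw [this]
    simp

lemma prod_boundaryEdges_zero {M : Type*} [CommMonoid M] (F : Edge W H → M) :
    ∏ e ∈ boundaryEdges 0, F e = ∏ y : Fin H, F (Sum.inr (0, y)) := by
  rw [boundaryEdges, Finset.prod_image]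
  intro a _ b _ hab
  simpa using hab

lemma prod_boundaryEdges_one {M : Type*} [CommMonoid M] (F : Edge W H → M) :
    ∏ e ∈ boundaryEdges 1, F e = ∏ x : Fin W, F (Sum.inl (x, Fin.last H)) := by
  rw [boundaryEdges, Finset.prod_image]
  intro a _ b _ hab
  simpa using hab

lemma prod_boundaryEdges_two {M : Type*} [CommMonoid M] (F : Edge W H → M) :
    ∏ e ∈ boundaryEdges 2, F e =
      (∏ y : Fin H, F (Sum.inr (Fin.last W, y))) * ∏ x : Fin W, F (Sum.inl (x, 0)) := by
  rw [boundaryEdges, Finset.prod_union, Finset.prod_image, Finset.prod_image]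
  · intro a _ b _ hab
    simpa using hab
  · intro a _ b _ hab
    simpa using hab
  · rw [Finset.disjoint_left]
    simp

/-- The discrete divergence theorem on the patch. -/
lemma prod_plaquette_div {M : Type*} [CommGroup M] (F : Edge W H → M) :
    ∏ p : Plaquette W H, F (bottomEdge p) * F (rightEdge p) / (F (leftEdge p) * F (topEdge p)) =
      (∏ e ∈ boundaryEdges 2, F e) / ((∏ e ∈ boundaryEdges 0, F e) * ∏ e ∈ boundaryEdges 1, F e) := by
  -- Horizontal edges telescope up each column and vertical edges along each row.
  have h1 : ∏ p : Plaquette W H, F (bottomEdge p) / F (topEdge p) =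
      (∏ x : Fin W, F (Sum.inl (x, 0))) / ∏ x : Fin W, F (Sum.inl (x, Fin.last H)) := by
    rw [Fintype.prod_prod_type, ← Finset.prod_div_distrib]
    exact Finset.prod_congr rfl fun x _ => prod_fin_div H fun y => F (Sum.inl (x, y))
  have h2 : ∏ p : Plaquette W H, F (leftEdge p) / F (rightEdge p) =
      (∏ y : Fin H, F (Sum.inr (0, y))) / ∏ y : Fin H, F (Sum.inr (Fin.last W, y)) := by
    rw [Fintype.prod_prod_type_right, ← Finset.prod_div_distrib]
    exact Finset.prod_congr rfl fun y _ => prod_fin_div W fun x => F (Sum.inr (x, y))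
  rw [prod_boundaryEdges_zero, prod_boundaryEdges_one, prod_boundaryEdges_two]
  calc _ = (∏ p : Plaquette W H, F (bottomEdge p) / F (topEdge p)) /
        ∏ p : Plaquette W H, F (leftEdge p) / F (rightEdge p) := by
        rw [← Finset.prod_div_distrib]
        refine Finset.prod_congr rfl fun p _ => ?_
        rw [div_div_div_eq, mul_comm (F (leftEdge p))]
    _ = _ := by
        rw [h1, h2, div_div_div_eq, mul_comm (∏ x : Fin W, F (Sum.inl (x, 0))),
          mul_comm (∏ x : Fin W, F (Sum.inl (x, Fin.last H)))]

/-! ### Gauge invariance of the phase -/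

/-- The phase by which the gauge transformation of an edge `a`, with `g` at its initial and `g'` at
its terminal vertex, changes the adjacent triangles. -/
noncomputable def edgeCochain (α : G → G → Circle) (g a g' : G) : Circle :=
  α g a / α (g * a * g'⁻¹) g'

/-- A cocycle changes under gauge transformations by a coboundary (a triangular prism). -/
lemma cocycle_gauge {α : G → G → Circle} (hα : IsTwoCocycle α) (g g' g'' a b : G) :
    α (g * a * g'⁻¹) (g' * b * g''⁻¹) =
      α a b * edgeCochain α g (a * b) g'' / (edgeCochain α g a g' * edgeCochain α g' b g'') := by
  -- The three tetrahedra into which the prism is cut. Their two common inner faces, `α (g * a) b`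
  -- and `α (g * a * g'⁻¹) (g' * b)`, are eliminated by the final linear combination.
  have e1 := hα g a b
  have e2 := hα (g * a * g'⁻¹) g' b
  have e3 := hα (g * a * g'⁻¹) (g' * b * g''⁻¹) g''
  simp only [mul_assoc, inv_mul_cancel, mul_one, inv_mul_cancel_left] at e1 e2 e3
  simp only [edgeCochain, mul_assoc]
  generalize α (g * (a * g'⁻¹)) g' = Y at *
  generalize α g' b = U at *
  generalize α (g' * (b * g''⁻¹)) g'' = V at *
  generalize α g a = P at *
  apply Circle.ext
  replace e1 := congrArg ((↑) : Circle → ℂ) e1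
  replace e2 := congrArg ((↑) : Circle → ℂ) e2
  replace e3 := congrArg ((↑) : Circle → ℂ) e3
  simp only [Circle.coe_mul, Circle.coe_div] at *
  field_simp
  linear_combination (P : ℂ) * U * e3 - (V : ℂ) * P * e2 + (V : ℂ) * Y * e1

/-- Both triangles have the same diagonal, since `hp` equates its two holonomies. Its cochain occurs
once in the numerator and once in the denominator, which leaves the four edges. -/
lemma plaquettePhase_gauge {α : G → G → Circle} (hα : IsTwoCocycle α) (γ : Vertex W H → G)
    {h : Config G W H} {p : Plaquette W H}
    (hp : h (leftEdge p) * h (topEdge p) = h (bottomEdge p) * h (rightEdge p))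
    {F : Edge W H → Circle} (hF : ∀ e, F e = edgeCochain α (γ (src e)) (h e) (γ (tgt e))) :
    plaquettePhase α p (gauge γ h) = plaquettePhase α p h *
      (F (bottomEdge p) * F (rightEdge p) / (F (leftEdge p) * F (topEdge p))) := by
  have h1 := cocycle_gauge hα (γ (src (leftEdge p))) (γ (tgt (leftEdge p))) (γ (tgt (topEdge p)))
    (h (leftEdge p)) (h (topEdge p))
  have h2 := cocycle_gauge hα (γ (src (leftEdge p))) (γ (tgt (bottomEdge p))) (γ (tgt (topEdge p)))
    (h (bottomEdge p)) (h (rightEdge p))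
  have h3 : plaquettePhase α p (gauge γ h) =
    α (γ (src (leftEdge p)) * h (leftEdge p) * (γ (tgt (leftEdge p)))⁻¹)
      (γ (tgt (leftEdge p)) * h (topEdge p) * (γ (tgt (topEdge p)))⁻¹) /
    α (γ (src (leftEdge p)) * h (bottomEdge p) * (γ (tgt (bottomEdge p)))⁻¹)
      (γ (tgt (bottomEdge p)) * h (rightEdge p) * (γ (tgt (topEdge p)))⁻¹) := rfl
  rw [h3, h1, h2, hp, plaquettePhase, hF, hF, hF, hF]
  have s1 : src (bottomEdge p) = src (leftEdge p) := rfl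
  have s2 : src (rightEdge p) = tgt (bottomEdge p) := rfl
  have s3 : tgt (rightEdge p) = tgt (topEdge p) := rfl
  have s4 : src (topEdge p) = tgt (leftEdge p) := rfl
  rw [s1, s2, s3, s4]
  apply Circle.ext
  simp only [Circle.coe_mul, Circle.coe_div]
  field_simp

/-- The term `β (g * a)` is common to both values of `α` and cancels. The first factor of the result
telescopes along a boundary; the second is the inverse of the change of the counterterm `β`. -/
lemma edgeCochain_eq {α : G → G → Circle} {L : Subgroup G} {β : G → Circle}
    (hβ : TrivialisesOn α L β) {g a g' : G} (hg : g ∈ L) (ha : a ∈ L) (hg' : g' ∈ L) :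
    edgeCochain α g a g' = (β g / β g') * (β a / β (g * a * g'⁻¹)) := by
  rw [edgeCochain, hβ g hg a ha, hβ _ (mul_mem (mul_mem hg ha) (inv_mem hg')) g' hg']
  simp only [mul_assoc, inv_mul_cancel, mul_one]
  rw [div_div_div_cancel_right, mul_div_mul_comm, div_mul_div_comm, div_mul_div_comm, mul_comm (β g')]

lemma sptPhase_gauge {K : Fin 3 → Subgroup G} {α : G → G → Circle} {β : Fin 3 → G → Circle}
    (hα : IsTwoCocycle α) (hβ : ∀ i, TrivialisesOn α (K i) (β i))
    (hcorner : ∀ i j, ∀ g ∈ K i ⊓ K j, β i g = β j g) (hW : 0 < W) (hH : 0 < H)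
    {γ : Vertex W H → G} (hγ : γ ∈ gaugeGroup K W H) {h : Config G W H} (hh : Admissible K h) :
    sptPhase α β (gauge γ h) = sptPhase α β h := by
  obtain ⟨F, hF⟩ : ∃ F : Edge W H → Circle,
    ∀ e, F e = edgeCochain α (γ (src e)) (h e) (γ (tgt e)) := ⟨_, fun _ => rfl⟩
  have hb : ∀ i, ∀ e ∈ boundaryEdges i, β i (gauge γ h e) * F e =
      β i (h e) * (β i (γ (src e)) / β i (γ (tgt e))) := by
    intro i e he
    rw [hF, edgeCochain_eq (hβ i) (gaugeGroup_apply_mem hγ he (Or.inl rfl)) (hh.2 i e he)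
      (gaugeGroup_apply_mem hγ he (Or.inr rfl)), gauge, mul_left_comm, mul_div_cancel, mul_comm]
  have hB : ∀ i, (∏ e ∈ boundaryEdges i, β i (gauge γ h e)) * ∏ e ∈ boundaryEdges i, F e =
      (∏ e ∈ boundaryEdges i, β i (h e)) *
        ∏ e ∈ boundaryEdges i, β i (γ (src e)) / β i (γ (tgt e)) := by
    intro i
    rw [← Finset.prod_mul_distrib, ← Finset.prod_mul_distrib]
    exact Finset.prod_congr rfl (hb i)
  have t0 : ∏ e ∈ boundaryEdges 0, β 0 (γ (src e)) / β 0 (γ (tgt e)) =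
      β 0 (γ (0, 0)) / β 0 (γ (0, Fin.last H)) := by
    rw [prod_boundaryEdges_zero]
    exact prod_fin_div H fun y => β 0 (γ (0, y))
  have t1 : ∏ e ∈ boundaryEdges 1, β 1 (γ (src e)) / β 1 (γ (tgt e)) =
      β 1 (γ (0, Fin.last H)) / β 1 (γ (Fin.last W, Fin.last H)) := by
    rw [prod_boundaryEdges_one]
    exact prod_fin_div W fun x => β 1 (γ (x, Fin.last H))
  -- The vertex at the bend, `(Fin.last W, 0)`, occurs once in a numerator and once in a
  -- denominator, so the bend needs no compatibility condition.
  have t2 : ∏ e ∈ boundaryEdges 2, β 2 (γ (src e)) / β 2 (γ (tgt e)) =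
      β 2 (γ (Fin.last W, 0)) / β 2 (γ (Fin.last W, Fin.last H)) *
        (β 2 (γ (0, 0)) / β 2 (γ (Fin.last W, 0))) := by
    rw [prod_boundaryEdges_two]
    congr 1
    · exact prod_fin_div H fun y => β 2 (γ (Fin.last W, y))
    · exact prod_fin_div W fun x => β 2 (γ (x, 0))
  -- Positive side lengths provide edges of both boundaries at each corner, which place the value of
  -- `γ` there in both subgroups.
  obtain ⟨W, rfl⟩ := Nat.exists_eq_succ_of_ne_zero hW.ne'
  obtain ⟨H, rfl⟩ := Nat.exists_eq_succ_of_ne_zero hH.ne'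
  have c02 : β 0 (γ (0, 0)) = β 2 (γ (0, 0)) := by
    refine hcorner 0 2 _ ⟨?_, ?_⟩
    · exact gaugeGroup_apply_mem hγ (e := Sum.inr (0, 0)) (by simp [boundaryEdges]) (Or.inl rfl)
    · exact gaugeGroup_apply_mem hγ (e := Sum.inl (0, 0)) (by simp [boundaryEdges]) (Or.inl rfl)
  have c01 : β 0 (γ (0, Fin.last _)) = β 1 (γ (0, Fin.last _)) := by
    refine hcorner 0 1 _ ⟨?_, ?_⟩
    · exact gaugeGroup_apply_mem hγ (e := Sum.inr (0, Fin.last H)) (by simp [boundaryEdges])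
        (Or.inr rfl)
    · exact gaugeGroup_apply_mem hγ (e := Sum.inl (0, Fin.last _)) (by simp [boundaryEdges])
        (Or.inl rfl)
  have c12 : β 1 (γ (Fin.last _, Fin.last _)) = β 2 (γ (Fin.last _, Fin.last _)) := by
    refine hcorner 1 2 _ ⟨?_, ?_⟩
    · exact gaugeGroup_apply_mem hγ (e := Sum.inl (Fin.last W, Fin.last _))
        (by simp [boundaryEdges]) (Or.inr rfl)
    · exact gaugeGroup_apply_mem hγ (e := Sum.inr (Fin.last _, Fin.last H))
        (by simp [boundaryEdges]) (Or.inr rfl)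
  have hp : ∏ p, plaquettePhase α p (gauge γ h) = (∏ p, plaquettePhase α p h) *
      ((∏ e ∈ boundaryEdges 2, F e) /
        ((∏ e ∈ boundaryEdges 0, F e) * ∏ e ∈ boundaryEdges 1, F e)) := by
    rw [← prod_plaquette_div, ← Finset.prod_mul_distrib]
    exact Finset.prod_congr rfl fun p _ => plaquettePhase_gauge hα γ (hh.1 p) hF
  have B0 := hB 0
  have B1 := hB 1
  have B2 := hB 2
  rw [t0, c02, c01] at B0
  rw [t1, c12] at B1
  rw [t2] at B2
  rw [sptPhase, sptPhase, hp]
  simp only [Finset.prod_inv_distrib]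
  generalize ∏ e ∈ boundaryEdges 0, F e = f0 at *
  generalize ∏ e ∈ boundaryEdges 1, F e = f1 at *
  generalize ∏ e ∈ boundaryEdges 2, F e = f2 at *
  rw [← eq_div_iff_mul_eq'] at B0 B1 B2
  rw [B0, B1, B2]
  apply Circle.ext
  simp only [Circle.coe_mul, Circle.coe_div, Circle.coe_inv]
  field_simp

/-! ### The magnetic configuration -/

/-- The configuration created from the vacuum by the three ribbon operators. -/
def magneticConfig (q : Plaquette W H) (g₁ g₂ : G) : Config G W H
  | Sum.inl (x, y) => if x = q.1 then (if q.2.succ ≤ y then g₂ else g₁ * g₂) else 1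
  | Sum.inr (x, y) => if y = q.2 ∧ x ≤ q.1.castSucc then g₁ else 1

lemma mem_ribbon₁_inr {q : Plaquette W H} {x : Fin (W + 1)} {y : Fin H} :
    (Sum.inr (x, y) : Edge W H) ∈ ribbon₁ q ↔ y = q.2 ∧ x ≤ q.1.castSucc := by
  simp only [ribbon₁, Finset.mem_image, Finset.mem_filter, Finset.mem_univ, true_and,
    Sum.inr.injEq, Prod.mk.injEq]
  constructor
  · rintro ⟨a, h, rfl, rfl⟩; exact ⟨rfl, h⟩
  · rintro ⟨rfl, h⟩; exact ⟨x, h, rfl, rfl⟩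

lemma mem_ribbon₂_inl {q : Plaquette W H} {x : Fin W} {y : Fin (H + 1)} :
    (Sum.inl (x, y) : Edge W H) ∈ ribbon₂ q ↔ x = q.1 ∧ q.2.succ ≤ y := by
  simp only [ribbon₂, Finset.mem_image, Finset.mem_filter, Finset.mem_univ, true_and,
    Sum.inl.injEq, Prod.mk.injEq]
  constructor
  · rintro ⟨a, h, rfl, rfl⟩; exact ⟨rfl, h⟩
  · rintro ⟨rfl, h⟩; exact ⟨y, h, rfl, rfl⟩

lemma mem_ribbon₃_inl {q : Plaquette W H} {x : Fin W} {y : Fin (H + 1)} :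
    (Sum.inl (x, y) : Edge W H) ∈ ribbon₃ q ↔ x = q.1 ∧ y ≤ q.2.castSucc := by
  simp only [ribbon₃, Finset.mem_image, Finset.mem_filter, Finset.mem_univ, true_and,
    Sum.inl.injEq, Prod.mk.injEq]
  constructor
  · rintro ⟨a, h, rfl, rfl⟩; exact ⟨rfl, h⟩
  · rintro ⟨rfl, h⟩; exact ⟨y, h, rfl, rfl⟩

lemma ketMagnetic_eq (K : Fin 3 → Subgroup G) (q : Plaquette W H) (g₁ g₂ : G) :
    ketMagnetic K q g₁ g₂ = orbitState K (magneticConfig q g₁ g₂) := by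
  rw [ketMagnetic, orbitState, mul_assoc, mul_assoc, ← Matrix.mulVec_mulVec]
  congr 1
  rw [ribbonOp, ribbonOp, ribbonOp, permOp_mul, permOp_mul, permOp_mulVec_ket]
  congr 1
  ext e
  rcases e with ⟨x, y⟩ | ⟨x, y⟩
  · have h1 : (Sum.inl (x, y) : Edge W H) ∉ ribbon₁ q := by simp [ribbon₁]
    simp only [Function.comp_apply, h1, mem_ribbon₂_inl, mem_ribbon₃_inl, if_false, Pi.one_apply,
      mul_one, magneticConfig]
    by_cases hx : x = q.1
    · by_cases hy : q.2.succ ≤ y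
      · have : ¬ y ≤ q.2.castSucc := by
          rw [not_le]; exact Fin.castSucc_lt_iff_succ_le.2 hy
        simp [hx, hy, this]
      · have : y ≤ q.2.castSucc := by
          rw [← not_lt, Fin.castSucc_lt_iff_succ_le]; exact hy
        simp [hx, hy, this]
    · simp [hx]
  · have h2 : (Sum.inr (x, y) : Edge W H) ∉ ribbon₂ q := by simp [ribbon₂]
    have h3 : (Sum.inr (x, y) : Edge W H) ∉ ribbon₃ q := by simp [ribbon₃]
    simp only [Function.comp_apply, h2, h3, mem_ribbon₁_inr, if_false, Pi.one_apply,
      mul_one, magneticConfig]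

lemma magneticConfig_one (q : Plaquette W H) : magneticConfig q (1 : G) 1 = 1 := by
  ext e
  rcases e with ⟨x, y⟩ | ⟨x, y⟩ <;> simp [magneticConfig]

lemma ketZero_eq_orbitState (K : Fin 3 → Subgroup G) : ketZero K W H = orbitState K 1 := rfl

lemma ketZero_eq_ketMagnetic (K : Fin 3 → Subgroup G) (q : Plaquette W H) :
    ketZero K W H = ketMagnetic K q 1 1 := by
  rw [ketMagnetic_eq, magneticConfig_one, ketZero_eq_orbitState]

lemma magneticConfig_leftEdge (q p : Plaquette W H) (g₁ g₂ : G) :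
    magneticConfig q g₁ g₂ (leftEdge p) = if p.2 = q.2 ∧ p.1 ≤ q.1 then g₁ else 1 := by
  simp [magneticConfig, leftEdge]

lemma magneticConfig_rightEdge (q p : Plaquette W H) (g₁ g₂ : G) :
    magneticConfig q g₁ g₂ (rightEdge p) = if p.2 = q.2 ∧ p.1 < q.1 then g₁ else 1 := by
  simp [magneticConfig, rightEdge, ← Fin.castSucc_lt_iff_succ_le]

lemma magneticConfig_topEdge (q p : Plaquette W H) (g₁ g₂ : G) :
    magneticConfig q g₁ g₂ (topEdge p) =
      if p.1 = q.1 then (if q.2 ≤ p.2 then g₂ else g₁ * g₂) else 1 := by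
  simp [magneticConfig, topEdge]

lemma magneticConfig_bottomEdge (q p : Plaquette W H) (g₁ g₂ : G) :
    magneticConfig q g₁ g₂ (bottomEdge p) =
      if p.1 = q.1 then (if q.2 < p.2 then g₂ else g₁ * g₂) else 1 := by
  simp [magneticConfig, bottomEdge, Fin.succ_le_castSucc_iff]

/-- Each case lists every comparison that `simp` needs to evaluate the conditionals in
`magneticConfig` around a plaquette. -/
lemma trichotomy_facts {ι : Type*} [LinearOrder ι] (a b : ι) :
    (a ≤ b ∧ a < b ∧ a ≠ b ∧ ¬ b ≤ a ∧ ¬ b < a) ∨ a = b ∨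
      (b ≤ a ∧ b < a ∧ a ≠ b ∧ ¬ a ≤ b ∧ ¬ a < b) := by
  rcases lt_trichotomy a b with h | h | h
  · exact Or.inl ⟨h.le, h, h.ne, h.not_ge, h.not_gt⟩
  · exact Or.inr (Or.inl h)
  · exact Or.inr (Or.inr ⟨h.le, h, h.ne', h.not_ge, h.not_gt⟩)

/-- Away from `q` a string enters and leaves a plaquette through opposite edges with equal labels.
At `q` the three strings meet, and flatness reads `g₁ * g₂ = (g₁ * g₂) * 1`. -/
lemma magneticConfig_admissible {K : Fin 3 → Subgroup G} (q : Plaquette W H) {g₁ g₂ : G}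
    (h₁ : g₁ ∈ K 0) (h₂ : g₂ ∈ K 1) (h₃ : g₁ * g₂ ∈ K 2) :
    Admissible K (magneticConfig q g₁ g₂) := by
  constructor
  · intro p
    rw [magneticConfig_leftEdge, magneticConfig_rightEdge, magneticConfig_topEdge,
      magneticConfig_bottomEdge]
    rcases trichotomy_facts p.1 q.1 with h | h | h <;>
      rcases trichotomy_facts p.2 q.2 with h' | h' | h'
    all_goals simp [h, h']
  · intro i e he
    fin_cases i
    · simp only [boundaryEdges, Finset.mem_image, Finset.mem_univ, true_and] at he
      obtain ⟨y, rfl⟩ := he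
      simp only [magneticConfig]
      split_ifs
      exacts [h₁, one_mem _]
    · simp only [boundaryEdges, Finset.mem_image, Finset.mem_univ, true_and] at he
      obtain ⟨x, rfl⟩ := he
      simp only [magneticConfig, Fin.le_last, if_true]
      split_ifs
      exacts [h₂, one_mem _]
    · simp only [boundaryEdges, Finset.mem_union, Finset.mem_image,
        Finset.mem_univ, true_and] at he
      obtain ⟨y, rfl⟩ | ⟨x, rfl⟩ := he
      · have : ¬ Fin.last W ≤ q.1.castSucc := not_le.2 (Fin.castSucc_lt_last _)
        simp only [magneticConfig, this, and_false, if_false]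
        exact one_mem _
      · have : ¬ q.2.succ ≤ 0 := not_le.2 (Fin.succ_pos _)
        simp only [magneticConfig, this, if_false]
        split_ifs
        exacts [h₃, one_mem _]

lemma IsTwoCocycle.one_right {α : G → G → Circle} (hα : IsTwoCocycle α) (g : G) :
    α g 1 = α 1 1 := by
  have := hα g 1 1
  simpa using this

lemma IsTwoCocycle.one_left {α : G → G → Circle} (hα : IsTwoCocycle α) (g : G) :
    α 1 g = α 1 1 := by
  have := hα 1 1 g
  simpa using this.symm

/-- The form `u / b * b ^ n` avoids the truncated exponent `n - 1`. -/
lemma prod_ite_eq_mul_pow {M : Type*} [CommGroup M] {n : ℕ} (a : Fin n) (u b : M) :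
    (∏ i : Fin n, if i = a then u else b) = u / b * b ^ n := by
  calc _ = ∏ i : Fin n, (if i = a then u / b else 1) * b := by
        refine Finset.prod_congr rfl fun i _ => ?_
        split_ifs <;> simp
    _ = _ := by rw [Finset.prod_mul_distrib]; simp

/-- In every plaquette other than `q` both triangles have a trivial leg, so both values of the
cocycle are `α 1 1`. At `q` only the lower triangle does. -/
lemma prod_plaquettePhase_magneticConfig {α : G → G → Circle} (hα : IsTwoCocycle α)
    (q : Plaquette W H) (g₁ g₂ : G) :
    ∏ p, plaquettePhase α p (magneticConfig q g₁ g₂) = α g₁ g₂ / α 1 1 := by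
  rw [Finset.prod_eq_single q]
  · simp [plaquettePhase, magneticConfig_leftEdge, magneticConfig_rightEdge,
      magneticConfig_topEdge, magneticConfig_bottomEdge, hα.one_right (g₁ * g₂)]
  · intro p _ hp
    rw [plaquettePhase, magneticConfig_leftEdge, magneticConfig_rightEdge, magneticConfig_topEdge,
      magneticConfig_bottomEdge]
    have hp' : ¬ (p.1 = q.1 ∧ p.2 = q.2) := fun h => hp (Prod.ext h.1 h.2)
    rcases trichotomy_facts p.1 q.1 with h | h | h <;>
      rcases trichotomy_facts p.2 q.2 with h' | h' | h'
    all_goals simp [h, h', hα.one_right g₁, hα.one_right g₂, hα.one_right (g₁ * g₂), hα.one_left g₁,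
      hα.one_left g₂, hα.one_left (g₁ * g₂)] at hp' ⊢
  · simp

/-- The cocycle need not be normalised: every `β i 1` equals `α 1 1`. These constants cancel because
opposite sides of the patch have equal lengths and two inverse counterterms face one counterterm and
the `α 1 1` from the plaquettes. -/
lemma sptPhase_magneticConfig {K : Fin 3 → Subgroup G} {α : G → G → Circle}
    {β : Fin 3 → G → Circle} (hα : IsTwoCocycle α) (hβ : ∀ i, TrivialisesOn α (K i) (β i))
    (q : Plaquette W H) (g₁ g₂ : G) :
    sptPhase α β (magneticConfig q g₁ g₂) =
      α g₁ g₂ * β 2 (g₁ * g₂) / (β 0 g₁ * β 1 g₂) := by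
  have hb : ∀ i, β i 1 = α 1 1 := fun i => by
    have := hβ i 1 (one_mem _) 1 (one_mem _)
    simpa using this.symm
  have hl : ¬ Fin.last W ≤ q.1.castSucc := not_le.2 (Fin.castSucc_lt_last _)
  have h0 : ¬ q.2.succ ≤ 0 := not_le.2 (Fin.succ_pos _)
  rw [sptPhase, prod_plaquettePhase_magneticConfig hα, prod_boundaryEdges_zero,
    prod_boundaryEdges_one, prod_boundaryEdges_two]
  simp only [magneticConfig, Fin.zero_le, and_true, Fin.le_last, if_true, hl, and_false, if_false,
    h0, apply_ite (β _), hb, Finset.prod_inv_distrib, prod_ite_eq_mul_pow, Finset.prod_const,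
    Finset.card_univ, Fintype.card_fin]
  apply Circle.ext
  simp only [Circle.coe_mul, Circle.coe_div, Circle.coe_inv, Circle.coe_pow]
  field_simp

/-! ### Electric operators -/

/-- The factors at inner vertices cancel between consecutive edges; the induction peels off the
first edge, since the product is ordered. -/
lemma holonomy_below_gauge {n : ℕ} (F : Fin (n + 1) → G) (a : Fin n → G) (c : Fin (n + 1)) :
    (((List.finRange n).filter fun x => x.castSucc < c).map
      fun x => F x.castSucc * a x * (F x.succ)⁻¹).prod =
    F 0 * (((List.finRange n).filter fun x => x.castSucc < c).map a).prod * (F c)⁻¹ := by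
  induction n with
  | zero =>
    have : c = 0 := Fin.fin_one_eq_zero c
    simp [this]
  | succ n ih =>
    refine Fin.cases ?_ (fun c => ?_) c
    · simp
    · have := ih (fun i => F i.succ) (fun i => a i.succ) c
      simp only [List.finRange_succ, List.filter_cons, Fin.castSucc_zero, Fin.succ_pos,
        decide_true, if_true, List.map_cons, List.prod_cons, List.filter_map, List.map_map,
        Function.comp_def, Fin.castSucc_succ, Fin.succ_lt_succ_iff]
      simp only [← Fin.castSucc_succ] at this ⊢
      rw [this]
      group

lemma holonomy_above_gauge {n : ℕ} (F : Fin (n + 1) → G) (a : Fin n → G) (c : Fin (n + 1)) :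
    (((List.finRange n).filter fun x => c ≤ x.castSucc).map
      fun x => F x.castSucc * a x * (F x.succ)⁻¹).prod =
    F c * (((List.finRange n).filter fun x => c ≤ x.castSucc).map a).prod * (F (Fin.last n))⁻¹ := by
  induction n with
  | zero =>
    have : c = 0 := Fin.fin_one_eq_zero c
    simp [this]
  | succ n ih =>
    refine Fin.cases ?_ (fun c => ?_) c
    · have := ih (fun i => F i.succ) (fun i => a i.succ) 0
      simp only [List.finRange_succ, List.filter_cons, Fin.castSucc_zero,
        decide_true, if_true, List.map_cons, List.prod_cons, List.filter_map, List.map_map,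
        Function.comp_def, Fin.zero_le] at this ⊢
      simp only [Fin.castSucc_succ, Fin.succ_last, Fin.succ_zero_eq_one] at this ⊢
      rw [this]
      simp
      group
    · have := ih (fun i => F i.succ) (fun i => a i.succ) c
      have h0 : ¬ c.succ ≤ 0 := not_le.2 (Fin.succ_pos _)
      simp only [List.finRange_succ, List.filter_cons, Fin.castSucc_zero, h0,
        decide_false, Bool.false_eq_true, if_false, List.filter_map, List.map_map,
        Function.comp_def, Fin.castSucc_succ, Fin.succ_le_succ_iff]
      simp only [Fin.succ_last] at this ⊢
      rw [this]

/-- A straight electric line crosses the magnetic strings in at most one edge, which gives its whole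
holonomy. -/
lemma prod_filter_map_ite {ι : Type*} [DecidableEq ι] (P : ι → Prop) [DecidablePred P] (a : ι)
    (g : G) {l : List ι} (hl : l.Nodup) (ha : a ∈ l) :
    ((l.filter P).map fun x => if x = a then g else 1).prod = if P a then g else 1 := by
  induction l with
  | nil => simp at ha
  | cons b l ih =>
    rw [List.nodup_cons] at hl
    by_cases hb : b = a
    · subst hb
      have h1 : ((l.filter P).map fun x => if x = b then g else 1).prod = 1 := by
        refine List.prod_eq_one fun z hz => ?_
        obtain ⟨x, hx, rfl⟩ := List.mem_map.1 hz
        rw [if_neg]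
        rintro rfl
        exact hl.1 (List.mem_filter.1 hx).1
      by_cases hP : P b <;> simp [hP, h1]
    · have := ih hl.2 ((List.mem_cons.1 ha).resolve_left (Ne.symm hb))
      by_cases hP : P b <;> simp [hP, hb, this]

section Electric

variable {K : Fin 3 → Subgroup G} {V₁ V₂ V₃ : Type*}
    [AddCommGroup V₁] [Module ℂ V₁] [AddCommGroup V₂] [Module ℂ V₂]
    [AddCommGroup V₃] [Module ℂ V₃]

lemma holLeft_gauge (γ : Vertex W H → G) (h : Config G W H) (c : Vertex W H) :
    holLeft (gauge γ h) c = γ (0, c.2) * holLeft h c * (γ c)⁻¹ :=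
  holonomy_below_gauge (fun x => γ (x, c.2)) (fun x => h (Sum.inl (x, c.2))) c.1

lemma holRight_gauge (γ : Vertex W H → G) (h : Config G W H) (c : Vertex W H) :
    holRight (gauge γ h) c = γ c * holRight h c * (γ (Fin.last W, c.2))⁻¹ :=
  holonomy_above_gauge (fun x => γ (x, c.2)) (fun x => h (Sum.inl (x, c.2))) c.1

lemma holUp_gauge (γ : Vertex W H → G) (h : Config G W H) (c : Vertex W H) :
    holUp (gauge γ h) c = γ c * holUp h c * (γ (c.1, Fin.last H))⁻¹ :=
  holonomy_above_gauge (fun y => γ (c.1, y)) (fun y => h (Sum.inr (c.1, y))) c.2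

/-- The amplitude of the network of `logicalZ` with given holonomies of the three lines. -/
def ElectricTriplet.amplitude (b : ElectricTriplet K V₁ V₂ V₃) (l u r : G) : ℂ :=
  b.l₃ (b.ρ₃ r⁻¹ (b.fusion (b.ρ₁ l⁻¹ b.v₁) (b.ρ₂ u b.v₂)))

/-- The boundary factors are absorbed by the invariant vectors and covector; the factor `g` at the
junction passes through the fusion map and cancels against the third line. -/
lemma ElectricTriplet.amplitude_gauge (b : ElectricTriplet K V₁ V₂ V₃) (l u r g : G) {k₀ k₁ k₂ : G}
    (h₀ : k₀ ∈ K 0) (h₁ : k₁ ∈ K 1) (h₂ : k₂ ∈ K 2) :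
    b.amplitude (k₀ * l * g⁻¹) (g * u * k₁⁻¹) (g * r * k₂⁻¹) = b.amplitude l u r := by
  have e1 : b.ρ₁ (k₀ * l * g⁻¹)⁻¹ b.v₁ = b.ρ₁ g (b.ρ₁ l⁻¹ b.v₁) := by
    rw [show (k₀ * l * g⁻¹)⁻¹ = g * l⁻¹ * k₀⁻¹ by group, map_mul, map_mul, Module.End.mul_apply,
      Module.End.mul_apply, b.v₁_inv _ (inv_mem h₀)]
  have e2 : b.ρ₂ (g * u * k₁⁻¹) b.v₂ = b.ρ₂ g (b.ρ₂ u b.v₂) := by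
    rw [map_mul, map_mul, Module.End.mul_apply, Module.End.mul_apply, b.v₂_inv _ (inv_mem h₁)]
  have e3 : (g * r * k₂⁻¹)⁻¹ = k₂ * r⁻¹ * g⁻¹ := by group
  rw [amplitude, e1, e2, e3, b.fusion_equivariant, ← Module.End.mul_apply, ← map_mul,
    inv_mul_cancel_right, map_mul, Module.End.mul_apply, b.l₃_inv _ h₂, amplitude]

lemma logicalZ_eq (b : ElectricTriplet K V₁ V₂ V₃) (c : Vertex W H) :
    logicalZ b c = Matrix.diagonal fun h =>
      b.amplitude (holLeft h c) (holUp h c) (holRight h c) := rfl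

lemma exists_vertical_edge (hH : 0 < H) (x : Fin (W + 1)) (y : Fin (H + 1)) :
    ∃ y' : Fin H, src (Sum.inr (x, y') : Edge W H) = (x, y) ∨
      tgt (Sum.inr (x, y') : Edge W H) = (x, y) := by
  obtain ⟨H, rfl⟩ := Nat.exists_eq_succ_of_ne_zero hH.ne'
  refine Fin.cases ⟨0, Or.inl rfl⟩ (fun y => ⟨y, Or.inr rfl⟩) y

lemma exists_horizontal_edge (hW : 0 < W) (x : Fin (W + 1)) (y : Fin (H + 1)) :
    ∃ x' : Fin W, src (Sum.inl (x', y) : Edge W H) = (x, y) ∨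
      tgt (Sum.inl (x', y) : Edge W H) = (x, y) := by
  obtain ⟨W, rfl⟩ := Nat.exists_eq_succ_of_ne_zero hW.ne'
  refine Fin.cases ⟨0, Or.inl rfl⟩ (fun x => ⟨x, Or.inr rfl⟩) x

lemma amplitude_gauge_invariant (hW : 0 < W) (hH : 0 < H) (b : ElectricTriplet K V₁ V₂ V₃)
    (c : Vertex W H) {γ : Vertex W H → G} (hγ : γ ∈ gaugeGroup K W H) (h : Config G W H) :
    b.amplitude (holLeft (gauge γ h) c) (holUp (gauge γ h) c) (holRight (gauge γ h) c) =
      b.amplitude (holLeft h c) (holUp h c) (holRight h c) := by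
  rw [holLeft_gauge, holUp_gauge, holRight_gauge]
  apply b.amplitude_gauge
  · obtain ⟨y, hy⟩ := exists_vertical_edge (W := W) hH 0 c.2
    exact gaugeGroup_apply_mem hγ (e := Sum.inr (0, y)) (by simp [boundaryEdges]) hy
  · obtain ⟨x, hx⟩ := exists_horizontal_edge (H := H) hW c.1 (Fin.last H)
    exact gaugeGroup_apply_mem hγ (e := Sum.inl (x, Fin.last H)) (by simp [boundaryEdges]) hx
  · obtain ⟨y, hy⟩ := exists_vertical_edge (W := W) hH (Fin.last W) c.2
    exact gaugeGroup_apply_mem hγ (e := Sum.inr (Fin.last W, y)) (by simp [boundaryEdges]) hy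

lemma holLeft_magneticConfig (q : Plaquette W H) (g₁ g₂ : G) (c : Vertex W H) :
    holLeft (magneticConfig q g₁ g₂) c =
      if q.1.castSucc < c.1 then (if q.2.succ ≤ c.2 then g₂ else g₁ * g₂) else 1 :=
  prod_filter_map_ite (fun x : Fin W => x.castSucc < c.1) q.1 _ (List.nodup_finRange W)
    (List.mem_finRange _)

lemma holRight_magneticConfig (q : Plaquette W H) (g₁ g₂ : G) (c : Vertex W H) :
    holRight (magneticConfig q g₁ g₂) c =
      if c.1 ≤ q.1.castSucc then (if q.2.succ ≤ c.2 then g₂ else g₁ * g₂) else 1 :=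
  prod_filter_map_ite (fun x : Fin W => c.1 ≤ x.castSucc) q.1 _ (List.nodup_finRange W)
    (List.mem_finRange _)

lemma holUp_magneticConfig (q : Plaquette W H) (g₁ g₂ : G) (c : Vertex W H) :
    holUp (magneticConfig q g₁ g₂) c =
      if c.2 ≤ q.2.castSucc then (if c.1 ≤ q.1.castSucc then g₁ else 1) else 1 := by
  rw [← prod_filter_map_ite (fun y : Fin H => c.2 ≤ y.castSucc) q.2 _ (List.nodup_finRange H)
    (List.mem_finRange _), holUp]
  congr 2
  ext1 y
  simp only [magneticConfig, ite_and]

/-- In each of the four quadrants of `c` relative to `q`, the three holonomies are gauge equivalent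
to `(1, g₁, 1)`, whose amplitude is the braiding. -/
lemma amplitude_magneticConfig (b : ElectricTriplet K V₁ V₂ V₃) (c : Vertex W H)
    (q : Plaquette W H) {g₁ g₂ : G} (h₁ : g₁ ∈ K 0) (h₂ : g₂ ∈ K 1) (h₃ : g₁ * g₂ ∈ K 2) :
    b.amplitude (holLeft (magneticConfig q g₁ g₂) c) (holUp (magneticConfig q g₁ g₂) c)
      (holRight (magneticConfig q g₁ g₂) c) = b.braiding g₁ := by
  have hbr : b.braiding g₁ = b.amplitude 1 g₁ 1 := by
    simp [ElectricTriplet.braiding, ElectricTriplet.amplitude]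
  rw [holLeft_magneticConfig, holRight_magneticConfig, holUp_magneticConfig, hbr]
  have hx : q.1.castSucc < c.1 ↔ ¬ c.1 ≤ q.1.castSucc := not_le.symm
  have hy : q.2.succ ≤ c.2 ↔ ¬ c.2 ≤ q.2.castSucc := by
    rw [not_le, Fin.castSucc_lt_iff_succ_le]
  simp only [hx, hy]
  by_cases cx : c.1 ≤ q.1.castSucc <;> by_cases cy : c.2 ≤ q.2.castSucc <;>
    simp only [cx, cy, not_true_eq_false, not_false_eq_true, if_true, if_false]
  -- The fourth argument is the transformation at `c`; the membership proofs determine those at the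
  -- ends of the lines.
  · have := b.amplitude_gauge 1 g₁ 1 1 (one_mem _) (one_mem _) (inv_mem h₃)
    simpa using this
  · have := b.amplitude_gauge 1 g₁ 1 g₁⁻¹ (inv_mem h₁) (one_mem _) (inv_mem h₃)
    simpa [mul_assoc] using this
  · have := b.amplitude_gauge 1 g₁ 1 (g₁ * g₂)⁻¹ (one_mem _) (inv_mem h₂) (inv_mem h₃)
    simpa using this
  · have := b.amplitude_gauge 1 g₁ 1 (g₁ * g₂)⁻¹ (inv_mem h₁) (inv_mem h₂) (inv_mem h₃)
    simpa [mul_assoc] using this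

lemma amplitude_one (b : ElectricTriplet K V₁ V₂ V₃) (c : Vertex W H) :
    b.amplitude (holLeft 1 c) (holUp 1 c) (holRight 1 c) = 1 := by
  simp [holLeft, holUp, holRight, ElectricTriplet.amplitude, b.normalised]

end Electric

/-! ### Locality -/

lemma diagonal_circle_mem_unitaryGroup (f : Config G W H → Circle) :
    (Matrix.diagonal fun h => (f h : ℂ)) ∈ Matrix.unitaryGroup (Config G W H) ℂ := by
  rw [Matrix.mem_unitaryGroup_iff, Matrix.star_eq_conjTranspose, Matrix.diagonal_conjTranspose,
    Matrix.diagonal_mul_diagonal, ← Matrix.diagonal_one]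
  congr 1
  ext h
  simp [← Circle.coe_inv_eq_conj]

lemma supportedOn_diagonal {S : Finset (Edge W H)} {f : Config G W H → ℂ}
    (hf : ∀ h k, (∀ e ∈ S, h e = k e) → f h = f k) : SupportedOn S (Matrix.diagonal f) := by
  constructor
  · rintro h h' ⟨e, -, he⟩
    exact Matrix.diagonal_apply_ne _ fun hh => he (congrFun hh e)
  · intro h h' k k' hS hS'
    have hiff : h = h' ↔ k = k' := by
      constructor
      · rintro rfl
        ext e
        by_cases he : e ∈ S
        · rw [← (hS e he).1, ← (hS e he).2]
        · exact (hS' e he).2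
      · rintro rfl
        ext e
        by_cases he : e ∈ S
        · rw [(hS e he).1, (hS e he).2]
        · exact (hS' e he).1
    rw [Matrix.diagonal_apply, Matrix.diagonal_apply]
    by_cases hh : h = h'
    · rw [if_pos hh, if_pos (hiff.1 hh), hf h k fun e he => (hS e he).1]
    · rw [if_neg hh, if_neg (mt hiff.2 hh)]

lemma plaquettePhase_congr (α : G → G → Circle) {p : Plaquette W H} {h k : Config G W H}
    (hk : ∀ e ∈ plaquetteEdges p, h e = k e) : plaquettePhase α p h = plaquettePhase α p k := by
  unfold plaquettePhase
  rw [hk (leftEdge p) (by simp [plaquetteEdges]), hk (topEdge p) (by simp [plaquetteEdges]),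
    hk (rightEdge p) (by simp [plaquetteEdges]), hk (bottomEdge p) (by simp [plaquetteEdges])]

lemma exists_mem_plaquetteEdges (hW : 0 < W) (hH : 0 < H) (e : Edge W H) :
    ∃ p, e ∈ plaquetteEdges p := by
  obtain ⟨W, rfl⟩ := Nat.exists_eq_succ_of_ne_zero hW.ne'
  obtain ⟨H, rfl⟩ := Nat.exists_eq_succ_of_ne_zero hH.ne'
  rcases e with ⟨x, y⟩ | ⟨x, y⟩
  · refine Fin.cases ⟨(x, 0), ?_⟩ (fun y => ⟨(x, y), ?_⟩) y <;>
      simp [plaquetteEdges, leftEdge, topEdge, rightEdge, bottomEdge]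
  · refine Fin.cases ⟨(0, y), ?_⟩ (fun x => ⟨(x, y), ?_⟩) x <;>
      simp [plaquetteEdges, leftEdge, topEdge, rightEdge, bottomEdge]

/-- A product of diagonal unitary gates with disjoint supports is a layer. -/
lemma isLocalLayer_diagonal {ι : Type*} (s : Finset ι) (S : ι → Finset (Edge W H))
    (f : ι → Config G W H → Circle)
    (hS : ∀ i ∈ s, ∀ j ∈ s, i ≠ j → Disjoint (S i) (S j))
    (hf : ∀ i ∈ s, ∀ h k, (∀ e ∈ S i, h e = k e) → f i h = f i k)
    (hp : ∀ i ∈ s, ∃ p, S i ⊆ plaquetteEdges p) :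
    IsLocalLayer (Matrix.diagonal fun h => ((∏ i ∈ s, f i h : Circle) : ℂ)) := by
  refine ⟨s.toList.map fun i => (S i, Matrix.diagonal fun h => (f i h : ℂ)), ?_, ?_, ?_⟩
  · rw [List.pairwise_map]
    refine s.nodup_toList.imp_of_mem fun {i j} hi hj hij => ?_
    exact hS i (Finset.mem_toList.1 hi) j (Finset.mem_toList.1 hj) hij
  · intro a ha
    obtain ⟨i, hi, rfl⟩ := List.mem_map.1 ha
    rw [Finset.mem_toList] at hi
    exact ⟨diagonal_circle_mem_unitaryGroup _,
      supportedOn_diagonal fun h k hk => congrArg _ (hf i hi h k hk), hp i hi⟩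
  · rw [List.map_map]
    simp only [coe_circle_prod]
    exact (opProd_diagonal s fun i h => (f i h : ℂ)).symm

/-- Plaquettes that share an edge are neighbours, hence of opposite colour on the checkerboard. -/
lemma plaquetteEdges_disjoint {p q : Plaquette W H} (hpq : p ≠ q)
    (h : (p.1.val + p.2.val) % 2 = (q.1.val + q.2.val) % 2) :
    Disjoint (plaquetteEdges p) (plaquetteEdges q) := by
  obtain ⟨⟨x, hx⟩, ⟨y, hy⟩⟩ := p
  obtain ⟨⟨x', hx'⟩, ⟨y', hy'⟩⟩ := q
  have hne : ¬ (x = x' ∧ y = y') := by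
    rintro ⟨rfl, rfl⟩; exact hpq rfl
  rw [Finset.disjoint_left]
  intro e he he'
  simp only [plaquetteEdges, Finset.mem_insert, Finset.mem_singleton, leftEdge, topEdge, rightEdge,
    bottomEdge] at he he' h
  rcases he with rfl | rfl | rfl | rfl <;>
    simp [Fin.ext_iff] at he' <;> omega

/-- The phase contributed by a boundary edge. -/
noncomputable def boundaryPhase (β : Fin 3 → G → Circle) (i : Fin 3) (e : Edge W H)
    (h : Config G W H) : Circle :=
  if i = 2 then β i (h e) else (β i (h e))⁻¹

lemma sptPhase_eq (α : G → G → Circle) (β : Fin 3 → G → Circle) (h : Config G W H) :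
    sptPhase α β h = (∏ p, plaquettePhase α p h) *
      ∏ j ∈ Finset.univ.sigma fun i : Fin 3 => (boundaryEdges i : Finset (Edge W H)),
        boundaryPhase β j.1 j.2 h := by
  rw [Finset.prod_sigma, Fin.prod_univ_three, sptPhase]
  simp [boundaryPhase, mul_assoc]

/-- This lets the counterterms of all three boundaries share one layer. In a degenerate patch
opposite sides would coincide. -/
lemma boundaryEdges_eq_of_mem (hW : 0 < W) (hH : 0 < H) {i j : Fin 3} {e : Edge W H}
    (hi : e ∈ boundaryEdges i) (hj : e ∈ boundaryEdges j) : i = j := by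
  obtain ⟨W, rfl⟩ := Nat.exists_eq_succ_of_ne_zero hW.ne'
  obtain ⟨H, rfl⟩ := Nat.exists_eq_succ_of_ne_zero hH.ne'
  rcases e with ⟨⟨x, hx⟩, ⟨y, hy⟩⟩ | ⟨⟨x, hx⟩, ⟨y, hy⟩⟩ <;> fin_cases i <;> fin_cases j <;>
    simp [boundaryEdges, Fin.ext_iff] at hi hj ⊢ <;> omega

lemma isLocalCircuit_sptGate (α : G → G → Circle) (β : Fin 3 → G → Circle) (hW : 0 < W)
    (hH : 0 < H) : IsLocalCircuit 3 (sptGate α β W H) := by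
  classical
  have hplaq : ∀ r : ℕ, IsLocalLayer (Matrix.diagonal fun h : Config G W H =>
      ((∏ p ∈ Finset.univ.filter (fun p : Plaquette W H => (p.1.val + p.2.val) % 2 = r),
        plaquettePhase α p h : Circle) : ℂ)) := by
    intro r
    refine isLocalLayer_diagonal _ plaquetteEdges _ (fun p hp q hq hpq => ?_)
      (fun p _ h k hk => plaquettePhase_congr α hk) fun p _ => ⟨p, subset_rfl⟩
    exact plaquetteEdges_disjoint hpq
      ((Finset.mem_filter.1 hp).2.trans (Finset.mem_filter.1 hq).2.symm)
  have hbd : IsLocalLayer (Matrix.diagonal fun h : Config G W H =>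
      ((∏ j ∈ Finset.univ.sigma fun i : Fin 3 => (boundaryEdges i : Finset (Edge W H)),
        boundaryPhase β j.1 j.2 h : Circle) : ℂ)) := by
    refine isLocalLayer_diagonal _ (fun j => {j.2}) _ (fun i hi j hj hij => ?_)
      (fun j _ h k hk => ?_) fun j _ => ?_
    · rw [Finset.disjoint_singleton]
      intro h
      obtain ⟨i, e⟩ := i
      obtain ⟨j, e'⟩ := j
      simp only [Finset.mem_sigma, Finset.mem_univ, true_and] at hi hj h
      subst h
      obtain rfl := boundaryEdges_eq_of_mem hW hH hi hj
      exact hij rfl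
    · simp [boundaryPhase, hk j.2 (Finset.mem_singleton_self _)]
    · obtain ⟨p, hp⟩ := exists_mem_plaquetteEdges hW hH j.2
      exact ⟨p, by simpa using hp⟩
  have three : ∀ {a b c : Op G W H}, IsLocalLayer a → IsLocalLayer b → IsLocalLayer c →
      sptGate α β W H = a * b * c → IsLocalCircuit 3 (sptGate α β W H) := by
    intro a b c ha hb hc h
    refine ⟨[a, b, c], le_rfl, ?_, by simp [h, mul_assoc]⟩
    simp [ha, hb, hc]
  refine three (hplaq 0) (hplaq 1) hbd ?_
  simp only [Matrix.diagonal_mul_diagonal, sptGate_eq_diagonal]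
  congr 1
  ext h
  rw [← Circle.coe_mul, ← Circle.coe_mul, sptPhase_eq]
  congr 3
  rw [← Finset.prod_filter_mul_prod_filter_not Finset.univ
    (fun p : Plaquette W H => (p.1.val + p.2.val) % 2 = 0)]
  simp only [Nat.mod_two_ne_zero]

lemma subset_thicken (S : Finset (Edge W H)) : S ⊆ thicken S := Finset.subset_union_left

/-- The change of the phase under a modification on `S` depends on `thicken S` only. -/
lemma sptPhase_div_congr (α : G → G → Circle) (β : Fin 3 → G → Circle) {S : Finset (Edge W H)}
    {h h' k k' : Config G W H} (hh : ∀ e ∉ S, h e = h' e) (hk : ∀ e ∉ S, k e = k' e)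
    (hT : ∀ e ∈ thicken S, h e = k e ∧ h' e = k' e) :
    sptPhase α β h / sptPhase α β h' = sptPhase α β k / sptPhase α β k' := by
  simp only [sptPhase_eq, mul_div_mul_comm, ← Finset.prod_div_distrib]
  congr 1
  · refine Finset.prod_congr rfl fun p _ => ?_
    by_cases hp : Disjoint (plaquetteEdges p) S
    · rw [plaquettePhase_congr α fun e he => hh e (Finset.disjoint_left.1 hp he),
        plaquettePhase_congr α fun e he => hk e (Finset.disjoint_left.1 hp he), div_self', div_self']
    · have hsub : plaquetteEdges p ⊆ thicken S := fun e he =>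
        Finset.mem_union_right _ (Finset.mem_biUnion.2 ⟨p, by simpa using hp, he⟩)
      rw [plaquettePhase_congr α fun e he => (hT e (hsub he)).1,
        plaquettePhase_congr α fun e he => (hT e (hsub he)).2]
  · refine Finset.prod_congr rfl fun j _ => ?_
    simp only [boundaryPhase]
    by_cases hj : j.2 ∈ S
    · rw [(hT j.2 (subset_thicken S hj)).1, (hT j.2 (subset_thicken S hj)).2]
    · rw [hh _ hj, hk _ hj, div_self', div_self']

lemma conj_sptGate_apply (α : G → G → Circle) (β : Fin 3 → G → Circle) (O : Op G W H)
    (h h' : Config G W H) :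
    (sptGate α β W H * O * (sptGate α β W H).conjTranspose) h h' =
      ((sptPhase α β h / sptPhase α β h' : Circle) : ℂ) * O h h' := by
  rw [sptGate_eq_diagonal, Matrix.diagonal_conjTranspose, Matrix.mul_diagonal,
    Matrix.diagonal_mul, div_eq_mul_inv, Circle.coe_mul, Circle.coe_inv_eq_conj]
  simp only [Pi.star_apply, RCLike.star_def]
  ring

lemma supportedOn_conj_sptGate (α : G → G → Circle) (β : Fin 3 → G → Circle)
    {S : Finset (Edge W H)} {O : Op G W H} (hO : SupportedOn S O) :
    SupportedOn (thicken S) (sptGate α β W H * O * (sptGate α β W H).conjTranspose) := by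
  constructor
  · rintro h h' ⟨e, he, hne⟩
    rw [conj_sptGate_apply, hO.1 h h' ⟨e, fun h => he (subset_thicken S h), hne⟩, mul_zero]
  · intro h h' k k' hT hT'
    rw [conj_sptGate_apply, conj_sptGate_apply]
    have hiff : ∀ e, h e = h' e ↔ k e = k' e := by
      intro e
      by_cases he : e ∈ thicken S
      · rw [(hT e he).1, (hT e he).2]
      · simp [hT' e he]
    -- Agreement is known only off `thicken S`. If the two configurations differ somewhere off `S`,
    -- both entries vanish.
    by_cases hh : ∀ e ∉ S, h e = h' e
    · have hk : ∀ e ∉ S, k e = k' e := fun e he => (hiff e).1 (hh e he)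
      rw [sptPhase_div_congr α β hh hk hT,
        hO.2 h h' k k' (fun e he => hT e (subset_thicken S he)) fun e he => ⟨hh e he, hk e he⟩]
    · push Not at hh
      obtain ⟨e, he, hne⟩ := hh
      rw [hO.1 h h' ⟨e, he, hne⟩, hO.1 k k' ⟨e, he, mt (hiff e).2 hne⟩, mul_zero, mul_zero]

lemma card_plaquettes_le_two (e : Edge W H) :
    (Finset.univ.filter fun p : Plaquette W H => e ∈ plaquetteEdges p).card ≤ 2 := by
  have inj : ∀ f : Plaquette W H → Edge W H, Function.Injective f →
      (Finset.univ.filter fun p => e = f p).card ≤ 1 := by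
    intro f hf
    rw [Finset.card_le_one]
    intro a ha b hb
    exact hf ((Finset.mem_filter.1 ha).2.symm.trans (Finset.mem_filter.1 hb).2)
  have two : ∀ f g : Plaquette W H → Edge W H, Function.Injective f → Function.Injective g →
      (∀ p, e ∈ plaquetteEdges p → e = f p ∨ e = g p) →
      (Finset.univ.filter fun p : Plaquette W H => e ∈ plaquetteEdges p).card ≤ 2 := by
    intro f g hf hg hfg
    refine (Finset.card_le_card (t := (Finset.univ.filter fun p => e = f p) ∪
      Finset.univ.filter fun p => e = g p) fun p hp => ?_).trans
      ((Finset.card_union_le _ _).trans (add_le_add (inj f hf) (inj g hg)))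
    simpa using hfg p (Finset.mem_filter.1 hp).2
  rcases e with e | e
  · refine two topEdge bottomEdge ?_ ?_ fun p hp => ?_
    · rintro ⟨a, b⟩ ⟨c, d⟩ h
      simpa [topEdge] using h
    · rintro ⟨a, b⟩ ⟨c, d⟩ h
      simpa [bottomEdge] using h
    · simpa [plaquetteEdges, leftEdge, rightEdge] using hp
  · refine two leftEdge rightEdge ?_ ?_ fun p hp => ?_
    · rintro ⟨a, b⟩ ⟨c, d⟩ h
      simpa [leftEdge] using h
    · rintro ⟨a, b⟩ ⟨c, d⟩ h
      simpa [rightEdge] using h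
    · simpa [plaquetteEdges, topEdge, bottomEdge] using hp

lemma card_plaquetteEdges_le (p : Plaquette W H) : (plaquetteEdges p).card ≤ 4 :=
  Finset.card_le_four

lemma card_thicken_le (S : Finset (Edge W H)) : (thicken S).card ≤ 7 * S.card := by
  -- The constant is `7 = 1 + 2 * 3`: the edge itself and three further edges in each of at most two
  -- plaquettes.
  let N : Edge W H → Finset (Edge W H) := fun e =>
    insert e ((Finset.univ.filter fun p : Plaquette W H => e ∈ plaquetteEdges p).biUnion
      fun p => (plaquetteEdges p).erase e)
  have hN : ∀ e, (N e).card ≤ 7 := by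
    intro e
    refine (Finset.card_insert_le _ _).trans (Nat.succ_le_succ ?_)
    refine (Finset.card_biUnion_le_card_mul _ _ 3 fun p hp => ?_).trans
      (Nat.mul_le_mul_right 3 (card_plaquettes_le_two e))
    rw [Finset.card_erase_of_mem (Finset.mem_filter.1 hp).2]
    exact Nat.sub_le_sub_right (card_plaquetteEdges_le p) 1
  have hsub : thicken S ⊆ S.biUnion N := by
    intro e he
    rw [Finset.mem_biUnion]
    rcases Finset.mem_union.1 he with he | he
    · exact ⟨e, he, Finset.mem_insert_self _ _⟩
    · obtain ⟨p, hp, hep⟩ := Finset.mem_biUnion.1 he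
      obtain ⟨e', he'p, he'S⟩ := Finset.not_disjoint_iff.1 (Finset.mem_filter.1 hp).2
      refine ⟨e', he'S, ?_⟩
      by_cases hee : e = e'
      · exact hee ▸ Finset.mem_insert_self _ _
      · refine Finset.mem_insert_of_mem (Finset.mem_biUnion.2 ⟨p, by simpa using he'p, ?_⟩)
        exact Finset.mem_erase.2 ⟨hee, hep⟩
  calc _ ≤ (S.biUnion N).card := Finset.card_le_card hsub
    _ ≤ S.card * 7 := Finset.card_biUnion_le_card_mul _ _ 7 fun e _ => hN e
    _ = _ := mul_comm _ _

/-! ### Diagonal unitaries on the codespace and two-dimensional codespaces -/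

lemma map_diagonal_codespace {K : Fin 3 → Subgroup G} {f : Config G W H → Circle}
    (hf : ∀ γ ∈ gaugeGroup K W H, ∀ h, Admissible K h → f (gauge γ h) = f h) :
    (codespace K W H).map (Matrix.diagonal fun h => (f h : ℂ)).mulVecLin = codespace K W H := by
  apply le_antisymm
  · rintro _ ⟨ψ, hψ, rfl⟩
    exact diagonal_mulVec_mem_codespace (fun γ hγ h hh => by rw [hf γ hγ h hh]) hψ
  · intro ψ hψ
    -- The inverse phase is gauge invariant as well, so it supplies a preimage inside the codespace.
    refine ⟨(Matrix.diagonal fun h => (((f h)⁻¹ : Circle) : ℂ)).mulVec ψ,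
      diagonal_mulVec_mem_codespace (fun γ hγ h hh => by rw [hf γ hγ h hh]) hψ, ?_⟩
    ext h
    simp [Matrix.mulVec_diagonal]

open scoped ComplexOrder in
lemma span_pair_eq_of_orthogonal {n : Type*} [Fintype n] {C : Submodule ℂ (n → ℂ)}
    (hC : Module.finrank ℂ C = 2) {x y : n → ℂ} (hx : x ∈ C) (hy : y ∈ C) (hx0 : x ≠ 0)
    (hy0 : y ≠ 0) (hxy : star x ⬝ᵥ y = 0) : Submodule.span ℂ {x, y} = C := by
  have hli : LinearIndependent ℂ ![x, y] := by
    rw [LinearIndependent.pair_iff' hx0]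
    rintro a rfl
    rw [dotProduct_smul, smul_eq_mul, mul_eq_zero, dotProduct_star_self_eq_zero] at hxy
    rcases hxy with rfl | h
    · exact hy0 (zero_smul _ _)
    · exact hx0 h
  have hle : Submodule.span ℂ {x, y} ≤ C := by
    rw [Submodule.span_le]
    rintro z (rfl | rfl)
    exacts [hx, hy]
  refine Submodule.eq_of_le_of_finrank_eq hle ?_
  have := finrank_span_eq_card hli
  rw [Matrix.range_cons, Matrix.range_cons, Matrix.range_empty, Set.union_empty,
    Set.singleton_union] at this
  rw [hC, this, Fintype.card_fin]

end SPTGate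

theorem theorem1 {G : Type*} [Group G] [Fintype G] [DecidableEq G]
    (K : Fin 3 → Subgroup G) (α : G → G → Circle) (β : Fin 3 → G → Circle)
    (hα : IsTwoCocycle α)
    (hβ : ∀ i, TrivialisesOn α (K i) (β i))
    -- compatibility of the counterterms at the corners of the triangle
    (hcorner : ∀ i j, ∀ g ∈ K i ⊓ K j, β i g = β j g)
    (W H : ℕ) (hW : 0 < W) (hH : 0 < H)
    (V₁ V₂ V₃ : Type*) [AddCommGroup V₁] [Module ℂ V₁] [AddCommGroup V₂] [Module ℂ V₂]
    [AddCommGroup V₃] [Module ℂ V₃] :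
    -- a unitary circuit of depth three, whose gates act on the edges of one plaquette
    sptGate α β W H ∈ Matrix.unitaryGroup (Config G W H) ℂ ∧
    IsLocalCircuit 3 (sptGate α β W H) ∧
    -- local errors spread to neighbouring plaquettes only
    (∀ (S : Finset (Edge W H)) (O : Op G W H), SupportedOn S O →
      SupportedOn (thicken S) (sptGate α β W H * O * (sptGate α β W H).conjTranspose) ∧
      (thicken S).card ≤ 7 * S.card) ∧
    -- the codespace is preserved
    (codespace K W H).map (sptGate α β W H).mulVecLin = codespace K W H ∧
    -- the action on the trivial state
    ketZero K W H ∈ codespace K W H ∧ ketZero K W H ≠ 0 ∧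
    (sptGate α β W H).mulVec (ketZero K W H) = ketZero K W H ∧
    -- the action on all magnetic states
    (∀ (q : Plaquette W H) (g₁ g₂ : G), g₁ ∈ K 0 → g₂ ∈ K 1 → g₁ * g₂ ∈ K 2 →
      ketMagnetic K q g₁ g₂ ∈ codespace K W H ∧ ketMagnetic K q g₁ g₂ ≠ 0 ∧
      (sptGate α β W H).mulVec (ketMagnetic K q g₁ g₂) =
        ((α g₁ g₂ * β 2 (g₁ * g₂) / (β 0 g₁ * β 1 g₂) : Circle) : ℂ) • ketMagnetic K q g₁ g₂) ∧
    -- an electric and a magnetic triple with braiding `-1` encode a qubit, for which the two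
    -- states are the eigenstates of the logical `Z`
    (∀ (b : ElectricTriplet K V₁ V₂ V₃) (c : Vertex W H) (q : Plaquette W H) (g₁ g₂ : G),
      g₁ ∈ K 0 → g₂ ∈ K 1 → g₁ * g₂ ∈ K 2 → b.braiding g₁ = -1 →
      (∀ ψ ∈ codespace K W H, (logicalZ b c).mulVec ψ ∈ codespace K W H) ∧
      (logicalZ b c).mulVec (ketZero K W H) = ketZero K W H ∧
      (logicalZ b c).mulVec (ketMagnetic K q g₁ g₂) = -ketMagnetic K q g₁ g₂ ∧
      star (ketZero K W H) ⬝ᵥ ketMagnetic K q g₁ g₂ = 0) ∧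
    -- if the codespace is that of a single qubit, any second state completes `ketZero` to an
    -- orthogonal basis of it, so that the gate is diagonal on the whole codespace
    (Module.finrank ℂ (codespace K W H) = 2 →
      ∀ (q : Plaquette W H) (g₁ g₂ : G), g₁ ∈ K 0 → g₂ ∈ K 1 → g₁ * g₂ ∈ K 2 →
      ketMagnetic K q g₁ g₂ ≠ ketZero K W H →
      star (ketZero K W H) ⬝ᵥ ketMagnetic K q g₁ g₂ = 0 ∧
      Submodule.span ℂ {ketZero K W H, ketMagnetic K q g₁ g₂} = codespace K W H) := by
  have hinv : ∀ γ ∈ gaugeGroup K W H, ∀ h, Admissible K h →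
      sptPhase α β (gauge γ h) = sptPhase α β h := fun γ hγ h hh =>
    sptPhase_gauge hα hβ hcorner hW hH hγ hh
  have hmem : ∀ (q : Plaquette W H) (g₁ g₂ : G), g₁ ∈ K 0 → g₂ ∈ K 1 → g₁ * g₂ ∈ K 2 →
      ketMagnetic K q g₁ g₂ ∈ codespace K W H ∧ ketMagnetic K q g₁ g₂ ≠ 0 ∧
      (sptGate α β W H).mulVec (ketMagnetic K q g₁ g₂) =
        ((α g₁ g₂ * β 2 (g₁ * g₂) / (β 0 g₁ * β 1 g₂) : Circle) : ℂ) •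
          ketMagnetic K q g₁ g₂ := by
    intro q g₁ g₂ h₁ h₂ h₃
    have had := magneticConfig_admissible q h₁ h₂ h₃
    rw [ketMagnetic_eq]
    refine ⟨orbitState_mem_codespace had, orbitState_ne_zero _ _, ?_⟩
    rw [sptGate_eq_diagonal, diagonal_mulVec_orbitState fun γ hγ => by rw [hinv γ hγ _ had],
      sptPhase_magneticConfig hα hβ]
  -- The logical zero is the magnetic state with trivial fluxes at any plaquette, so its claims are
  -- the case `g₁ = g₂ = 1`, with phase one by `hphase`.
  let q₀ : Plaquette W H := (⟨0, hW⟩, ⟨0, hH⟩)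
  obtain ⟨z1, z2, z3⟩ := hmem q₀ 1 1 (one_mem _) (one_mem _) (by simp)
  have hphase : α 1 1 * β 2 (1 * 1) / (β 0 1 * β 1 1) = 1 := by
    have hb : ∀ i, β i 1 = α 1 1 := fun i => by
      have := hβ i 1 (one_mem _) 1 (one_mem _)
      simpa using this.symm
    rw [mul_one, hb, hb, hb, div_self']
  rw [hphase, Circle.coe_one, one_smul] at z3
  rw [← ketZero_eq_ketMagnetic] at z1 z2 z3
  refine ⟨?_, isLocalCircuit_sptGate α β hW hH, fun S O hO =>
    ⟨supportedOn_conj_sptGate α β hO, card_thicken_le S⟩, ?_, z1, z2, z3, hmem, ?_, ?_⟩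
  · rw [sptGate_eq_diagonal]
    exact diagonal_circle_mem_unitaryGroup _
  · rw [sptGate_eq_diagonal]
    exact map_diagonal_codespace hinv
  · intro b c q g₁ g₂ h₁ h₂ h₃ hbr
    have hZ := fun γ (hγ : γ ∈ gaugeGroup K W H) h =>
      amplitude_gauge_invariant hW hH b c hγ h
    have hZ0 : (logicalZ b c).mulVec (ketZero K W H) = ketZero K W H := by
      rw [ketZero_eq_orbitState, logicalZ_eq, diagonal_mulVec_orbitState fun γ hγ => hZ γ hγ 1,
        amplitude_one, one_smul]
    have hZ1 : (logicalZ b c).mulVec (ketMagnetic K q g₁ g₂) = -ketMagnetic K q g₁ g₂ := by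
      rw [ketMagnetic_eq, logicalZ_eq, diagonal_mulVec_orbitState fun γ hγ => hZ γ hγ _,
        amplitude_magneticConfig b c q h₁ h₂ h₃, hbr, neg_one_smul]
    refine ⟨fun ψ hψ => ?_, hZ0, hZ1, ?_⟩
    · rw [logicalZ_eq]
      exact diagonal_mulVec_mem_codespace (fun γ hγ h _ => hZ γ hγ h) hψ
    · rw [ketZero_eq_orbitState, ketMagnetic_eq]
      -- If the two orbit states coincided, the common state would have `Z` eigenvalues `1` and `-1`
      -- and would vanish.
      refine orbitState_orthogonal fun heq => (hmem q g₁ g₂ h₁ h₂ h₃).2.1 ?_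
      rw [← ketMagnetic_eq, ← ketZero_eq_orbitState] at heq
      rw [heq, hZ0] at hZ1
      rw [heq]
      exact self_eq_neg.1 hZ1
  · intro hdim q g₁ g₂ h₁ h₂ h₃ hne
    obtain ⟨m1, m2, -⟩ := hmem q g₁ g₂ h₁ h₂ h₃
    have horth : star (ketZero K W H) ⬝ᵥ ketMagnetic K q g₁ g₂ = 0 := by
      rw [ketZero_eq_orbitState, ketMagnetic_eq] at *
      exact orbitState_orthogonal hne
    exact ⟨horth, span_pair_eq_of_orthogonal hdim z1 m1 z2 m2 horth⟩
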